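/- Let $N\ge 1$ and $p\ge 0$ be integers and let $t_1,\dots,t_p\in\mathbb{C}$. Let $dM=\prod_i dM_{ii}\prod_{i<j}d(\mathrm{Re}\,M_{ij})\,d(\mathrm{Im}\,M_{ij})$ denote Lebesgue measure on the $N\times N$ Hermitian matrices, and consider the probability laws on Hermitian matrices with density proportional, with respect to $dM$, to - GUE: $e^{-\frac12\mathrm{Tr}\,M^2}$; - LUE, for $\gamma>-1$: $(\det M)^{\gamma}e^{-\mathrm{Tr}\,M}$ on positive definite $M$ (and $0$ elsewhere); - JUE, for $\gamma_1,\gamma_2>-1$: $(\det M)^{\gamma_1}\det(1-M)^{\gamma_2}$ on $0<M<1$ (and $0$ elsewhere). Equivalently, the eigenvalues have joint density proportional to $\prod_{i<j}(x_i-x_j)^2\prod_i w(x_i)$, with $w(x)=e^{-x^2/2}$ on $\mathbb{R}$, $w(x)=x^\gamma e^{-x}$ on $(0,\infty)$, and $w(x)=x^{\gamma_1}(1-x)^{\gamma_2}$ on $(0,1)$, respectively. Write $\mathbb{E}^{(H)}_N$, $\mathbb{E}^{(L)}_N$, $\mathbb{E}^{(J)}_N$ for the corresponding expectations. Let $H_n$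 be the monic Hermite polynomials, orthogonal with respect to $e^{-x^2/2}$ on $\mathbb{R}$, and let $$L^{(\gamma)}_n(x)=\sum_{j=0}^n\frac{(-1)^j\,\Gamma(n+\gamma+1)}{\Gamma(j+\gamma+1)\,(n-j)!\,j!}\,x^j,$$ $$J^{(\gamma_1,\gamma_2)}_n(x)=\frac{\Gamma(n+\gamma_1+1)}{\Gamma(n+\gamma_1+\gamma_2+1)}\sum_{j=0}^n\frac{(-1)^j}{j!\,(n-j)!}\,\frac{\Gamma(n+j+\gamma_1+\gamma_2+1)}{\Gamma(j+\gamma_1+1)}\,x^j$$ (with $J_0^{(\gamma_1,\gamma_2)}=1$). For a sequence $(\varphi_n)$ of univariate polynomials and a partition $\lambda=(\lambda_1\ge\dots\ge\lambda_p\ge0)$, let $$\Phi_\lambda(x_1,\dots,x_p)=\frac{\det\left[\varphi_{\lambda_i+p-i}(x_j)\right]_{i,j=1}^p}{\prod_{1\le i<j\le p}(x_i-x_j)},$$ which is a polynomial in $x_1,\dots,x_p$. Denote it by $\mathcal{H}_\lambda$, $\mathcal{L}^{(\gamma)}_\lambda$, $\mathcal{J}^{(\gamma_1,\gamma_2)}_\lambda$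 when $\varphi_n=H_n$, $L^{(\gamma)}_n$, $J^{(\gamma_1,\gamma_2)}_n$, respectively. Let $(N^p)=(N,\dots,N)$ with $p$ parts. Then the three laws above are well defined (the normalising constants are positive and finite), the expectations below converge absolutely, and (a) $\displaystyle\mathbb{E}^{(H)}_N\Big[\prod_{j=1}^p\det(t_j-M)\Big]=\mathcal{H}_{(N^p)}(t_1,\dots,t_p)$; (b) $\displaystyle\mathbb{E}^{(L)}_N\Big[\prod_{j=1}^p\det(t_j-M)\Big]=\Big(\prod_{j=N}^{p+N-1}(-1)^j\,j!\Big)\,\mathcal{L}^{(\gamma)}_{(N^p)}(t_1,\dots,t_p)$; (c) $\displaystyle\mathbb{E}^{(J)}_N\Big[\prod_{j=1}^p\det(t_j-M)\Big]=\Big(\prod_{j=N}^{p+N-1}(-1)^j\,j!\,\frac{\Gamma(j+\gamma_1+\gamma_2+1)}{\Gamma(2j+\gamma_1+\gamma_2+1)}\Big)\,\mathcal{J}^{(\gamma_1,\gamma_2)}_{(N^p)}(t_1,\dots,t_p)$. -/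

import Mathlib

open MeasureTheory
open scoped ComplexOrder

noncomputable section

namespace UnitaryEnsembles

/-! ### Random matrices -/

/-- The Hermitian `N × N` matrix with real coordinates `a`: the diagonal entries are `a i i`, and
for `i < j` the entry at `(i, j)` has real part `a i j` and imaginary part `a j i`. This is a
linear bijection from `ℝ^(N²)` onto the Hermitian matrices, under which the Lebesgue measure
`volume` becomes `dM = ∏ᵢ dMᵢᵢ ∏_{i<j} d(Re Mᵢⱼ) d(Im Mᵢⱼ)`. -/
def herm {N : ℕ} (a : Fin N → Fin N → ℝ) : Matrix (Fin N) (Fin N) ℂ :=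
  Matrix.of fun i j =>
    if i = j then (a i i : ℂ)
    else if i < j then (a i j : ℂ) + Complex.I * (a j i : ℂ)
    else (a j i : ℂ) - Complex.I * (a i j : ℂ)

/-- The measure on Hermitian matrices (in the coordinates of `herm`) whose density with respect to
`dM` is proportional to `f`, normalised to have total mass one. -/
def ensemble (N : ℕ) (f : Matrix (Fin N) (Fin N) ℂ → ℝ) : Measure (Fin N → Fin N → ℝ) :=
  ((volume.withDensity fun a => ENNReal.ofReal (f (herm a))) Set.univ)⁻¹ •
    (volume.withDensity fun a => ENNReal.ofReal (f (herm a)))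

/-- Gaussian unitary ensemble: density proportional to `exp (-Tr M² / 2)`. -/
def GUE (N : ℕ) : Measure (Fin N → Fin N → ℝ) :=
  ensemble N fun M => Real.exp (-(M * M).trace.re / 2)

open scoped Classical in
/-- Laguerre unitary ensemble: density proportional to `(det M) ^ γ * exp (-Tr M)` on the positive
definite matrices. -/
def LUE (N : ℕ) (γ : ℝ) : Measure (Fin N → Fin N → ℝ) :=
  ensemble N fun M => if M.PosDef then M.det.re ^ γ * Real.exp (-M.trace.re) else 0

open scoped Classical in
/-- Jacobi unitary ensemble: density proportional to `(det M) ^ γ₁ * (det (1 - M)) ^ γ₂` on the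
matrices with `0 < M < 1`. -/
def JUE (N : ℕ) (γ₁ γ₂ : ℝ) : Measure (Fin N → Fin N → ℝ) :=
  ensemble N fun M =>
    if M.PosDef ∧ (1 - M).PosDef then M.det.re ^ γ₁ * (1 - M).det.re ^ γ₂ else 0

/-! ### Classical orthogonal polynomials in one variable -/

/-- Monic Hermite polynomials, orthogonal for `exp (-x² / 2)` on `ℝ`. -/
def hermiteP (n : ℕ) : Polynomial ℝ := (Polynomial.hermite n).map (Int.castRingHom ℝ)

/-- Laguerre polynomials, orthogonal for `x ^ γ * exp (-x)` on `(0, ∞)`, of squared norm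
`Γ(n + γ + 1) / n!` and leading coefficient `(-1) ^ n / n!`. -/
def laguerreP (γ : ℝ) (n : ℕ) : Polynomial ℝ :=
  ∑ j ∈ Finset.range (n + 1), Polynomial.monomial j
    ((-1) ^ j * Real.Gamma (n + γ + 1) /
      (Real.Gamma (j + γ + 1) * (n - j).factorial * j.factorial))

/-- Jacobi polynomials, orthogonal for `x ^ γ₁ * (1 - x) ^ γ₂` on `(0, 1)`:
`Γ(n+γ₁+1) / Γ(n+γ₁+γ₂+1) * ∑ⱼ (-1)^j / (j! (n-j)!) * Γ(n+j+γ₁+γ₂+1) / Γ(j+γ₁+1) * x^j`.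
The quotient `Γ(n+j+γ₁+γ₂+1) / Γ(n+γ₁+γ₂+1)` is written as the rising factorial of
`n + γ₁ + γ₂ + 1` of length `j`, which also covers `n = 0`, `γ₁ + γ₂ = -1`, where
the quotient is to be read as its limit; see `gamma_quotient`. -/
def jacobiP (γ₁ γ₂ : ℝ) (n : ℕ) : Polynomial ℝ :=
  ∑ j ∈ Finset.range (n + 1), Polynomial.monomial j
    ((-1) ^ j / (j.factorial * (n - j).factorial) *
      (Real.Gamma (n + γ₁ + 1) / Real.Gamma (j + γ₁ + 1)) *
      (ascPochhammer ℝ j).eval (n + γ₁ + γ₂ + 1))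

/-- The rising factorial as a quotient of Gamma functions. -/
theorem gamma_quotient (x : ℝ) (hx : ∀ m : ℕ, x ≠ -m) (j : ℕ) :
    (ascPochhammer ℝ j).eval x = Real.Gamma (x + j) / Real.Gamma x := by
  have h0 := Real.Gamma_ne_zero hx
  induction j with
  | zero => simp [h0]
  | succ j ih =>
    have h1 : x + j ≠ 0 := fun h => hx j (by linarith)
    rw [ascPochhammer_succ_eval, ih, Nat.cast_succ, ← add_assoc, Real.Gamma_add_one h1]
    ring

/-! ### Multivariate orthogonal polynomials -/

/-- The Vandermonde product `Δ(x₁, …, x_p) = ∏_{i<j} (xᵢ - xⱼ)`. -/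
def vandermonde (p : ℕ) : MvPolynomial (Fin p) ℝ :=
  ∏ e ∈ Finset.univ.filter (fun e : Fin p × Fin p => e.1 < e.2),
    (MvPolynomial.X e.1 - MvPolynomial.X e.2)

/-- The determinant `det [φ_{λᵢ + p - i}(xⱼ)]`, `1 ≤ i, j ≤ p`. The indices of `Fin p` start at `0`,
so `Fin.rev i` is what is `p - i` when they start at `1`. -/
def alternant {p : ℕ} (φ : ℕ → Polynomial ℝ) (lam : Fin p → ℕ) : MvPolynomial (Fin p) ℝ :=
  (Matrix.of fun i j : Fin p =>
    Polynomial.aeval (MvPolynomial.X j : MvPolynomial (Fin p) ℝ)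
      (φ (lam i + (Fin.rev i : ℕ)))).det

/-- The substitution `xᵢ ↦ xⱼ`. -/
def merge {p : ℕ} (i j : Fin p) : MvPolynomial (Fin p) ℝ →ₐ[ℝ] MvPolynomial (Fin p) ℝ :=
  MvPolynomial.aeval (Function.update MvPolynomial.X i (MvPolynomial.X j))

theorem dvd_iff_merge {p : ℕ} (i j : Fin p) (f : MvPolynomial (Fin p) ℝ) :
    (MvPolynomial.X i - MvPolynomial.X j) ∣ f ↔ merge i j f = 0 := by
  constructor
  · rintro ⟨g, rfl⟩
    rw [map_mul]
    by_cases h : j = i <;> simp [merge, h]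
  · intro h
    suffices H : ∀ f : MvPolynomial (Fin p) ℝ,
        (MvPolynomial.X i - MvPolynomial.X j) ∣ f - merge i j f by
      simpa [h] using H f
    intro f
    induction f using MvPolynomial.induction_on with
    | C a => simp [merge]
    | add f g hf hg =>
      rw [map_add, add_sub_add_comm]
      exact dvd_add hf hg
    | mul_X f k hf =>
      have hk : (MvPolynomial.X i - MvPolynomial.X j : MvPolynomial (Fin p) ℝ) ∣
          MvPolynomial.X k - merge i j (MvPolynomial.X k) := by
        by_cases h : k = i
        · subst h; simp [merge]
        · simp [merge, h]
      rw [map_mul]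
      have : f * MvPolynomial.X k - merge i j f * merge i j (MvPolynomial.X k) =
          (f - merge i j f) * MvPolynomial.X k +
            merge i j f * (MvPolynomial.X k - merge i j (MvPolynomial.X k)) := by ring
      rw [this]
      exact dvd_add (hf.mul_right _) (hk.mul_left _)

theorem X_sub_X_ne_zero {p : ℕ} {i j : Fin p} (h : i ≠ j) :
    (MvPolynomial.X i - MvPolynomial.X j : MvPolynomial (Fin p) ℝ) ≠ 0 :=
  sub_ne_zero.2 fun e => h (MvPolynomial.X_injective e)

theorem vandermonde_ne_zero (p : ℕ) : vandermonde p ≠ 0 :=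
  Finset.prod_ne_zero_iff.2 fun _ he => X_sub_X_ne_zero (Finset.mem_filter.1 he).2.ne

theorem prime_X_sub_X {p : ℕ} {i j : Fin p} (h : i ≠ j) :
    Prime (MvPolynomial.X i - MvPolynomial.X j : MvPolynomial (Fin p) ℝ) := by
  refine ⟨X_sub_X_ne_zero h, fun hu => ?_, fun a b hab => ?_⟩
  · have := (dvd_iff_merge i j 1).1 hu.dvd
    simp at this
  · simpa [dvd_iff_merge] using hab

theorem vandermonde_dvd_alternant {p : ℕ} (φ : ℕ → Polynomial ℝ) (lam : Fin p → ℕ) :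
    vandermonde p ∣ alternant φ lam := by
  refine Finset.prod_dvd_of_isRelPrime ?_ ?_
  · intro e he e' he' hne
    have h1 : e.1 < e.2 := by simpa using he
    have h2 : e'.1 < e'.2 := by simpa using he'
    refine ((prime_X_sub_X h1.ne).irreducible.isRelPrime_iff_not_dvd).2 fun hd => ?_
    rw [dvd_iff_merge, map_sub, sub_eq_zero] at hd
    simp only [merge, MvPolynomial.aeval_X, Function.update_apply] at hd
    apply hne
    ext1 <;> split_ifs at hd <;> have := MvPolynomial.X_injective hd <;> omega
  · intro e he
    have h1 : e.1 < e.2 := by simpa using he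
    rw [dvd_iff_merge, alternant, AlgHom.map_det]
    refine Matrix.det_zero_of_column_eq h1.ne fun k => ?_
    simp [merge, ← Polynomial.aeval_algHom_apply, h1.ne']

/-- The multivariate polynomial `Φ_λ = det [φ_{λᵢ + p - i}(xⱼ)] / Δ` of a sequence `φ` of
univariate polynomials, for a partition `λ = (λ₁ ≥ … ≥ λ_p ≥ 0)`. The quotient is exact in the
polynomial ring; it is characterised by `vandermonde_mul_multi`. -/
def multi {p : ℕ} (φ : ℕ → Polynomial ℝ) (lam : Fin p → ℕ) : MvPolynomial (Fin p) ℝ :=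
  (vandermonde_dvd_alternant φ lam).choose

theorem vandermonde_mul_multi {p : ℕ} (φ : ℕ → Polynomial ℝ) (lam : Fin p → ℕ) :
    vandermonde p * multi φ lam = alternant φ lam :=
  (vandermonde_dvd_alternant φ lam).choose_spec.symm

/-- Multivariate Hermite polynomials. -/
def multiHermite {p : ℕ} (lam : Fin p → ℕ) : MvPolynomial (Fin p) ℝ := multi hermiteP lam

/-- Multivariate Laguerre polynomials. -/
def multiLaguerre {p : ℕ} (γ : ℝ) (lam : Fin p → ℕ) : MvPolynomial (Fin p) ℝ :=
  multi (laguerreP γ) lam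

/-- Multivariate Jacobi polynomials. -/
def multiJacobi {p : ℕ} (γ₁ γ₂ : ℝ) (lam : Fin p → ℕ) : MvPolynomial (Fin p) ℝ :=
  multi (jacobiP γ₁ γ₂) lam

/-- The rectangular partition `(N^p) = (N, …, N)` with `p` parts. -/
def rect (N p : ℕ) : Fin p → ℕ := fun _ => N

/-- The product `∏ⱼ det (tⱼ - M)` of characteristic polynomials. -/
def charProd {N p : ℕ} (t : Fin p → ℂ) (M : Matrix (Fin N) (Fin N) ℂ) : ℂ :=
  ∏ j, (t j • (1 : Matrix (Fin N) (Fin N) ℂ) - M).det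

end UnitaryEnsembles

end

/-! The integrand and the densities depend on a Hermitian matrix only through its characteristic
polynomial. The proof reduces the averages to integrals over eigenvalues and then evaluates these by
determinants of orthogonal polynomials. Below, Δ is a Vandermonde product.

Reduction (`exists_lintegral_herm_eq`). The Weyl formula is proved by induction on the size. Split a
matrix into its corner a, its border v and its block A. Integrating a class function over (a, v)
gives a class function of A, since conjugating A by a unitary only rotates v; so A may be taken
diagonal with increasing spectrum l. The spectrum m of the whole matrix then depends only on a, the
|v_i|² and l. When all v_i are nonzero, m strictly interlaces with l, and (a, |v_i|²) ↔ m is a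
bijection whose Jacobian is Δ(m)/Δ(l) (`image_borderData`, `abs_det_borderJac`). The induction
hypothesis supplies Δ(l)², which leaves Δ(l)Δ(m). The integral of Δ(l) over all l interlacing with m
is Δ(m)/N! (`integral_vdet_interlace`), so Δ(m)² reappears. The overall constant is cancelled by the
normalisation.

Evaluation (`diffProd_mul_integral`). Δ(t) ∏(t_j - x_i) Δ(x) is the Vandermonde product of the
joined tuple (t, x), hence a determinant in monic orthogonal polynomials of degrees 0, …, N+p-1. The
second factor Δ(x) is expanded over permutations and distributed over the rows of x, which are then
integrated one by one. Orthogonality makes the matrix block triangular, leaving the norms times the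
p × p determinant in t. The factor Δ(t) is cancelled in the polynomial ring, which covers coinciding
t_j, and the case p = 0 is the normalising constant. Passing to non-monic polynomials brings in the
inverse leading coefficients in degrees N, …, N+p-1: these are the prefactors in (b) and (c).

Orthogonality. For Hermite it is integration by parts. For Laguerre and Jacobi the moment sums are
n-th finite differences of polynomials of degree less than n (`sum_alternating_eval_eq_zero`). -/

noncomputable section

namespace UnitaryEnsembles

/-! ### Bordered Hermitian matrices -/

/-- The matrix with first row `(a, v)`, first column `(a, v̄)` and lower right block `A`. -/
def border {N : ℕ} (a : ℝ) (v : Fin N → ℂ) (A : Matrix (Fin N) (Fin N) ℂ) :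
    Matrix (Fin (N + 1)) (Fin (N + 1)) ℂ :=
  Matrix.of (Fin.cons (Fin.cons (a : ℂ) v) fun i => Fin.cons (star (v i)) (A i))

section border

variable {N : ℕ} (a : ℝ) (v : Fin N → ℂ) (A : Matrix (Fin N) (Fin N) ℂ)

@[simp] theorem border_zero_zero : border a v A 0 0 = a := rfl
@[simp] theorem border_zero_succ (j : Fin N) : border a v A 0 j.succ = v j := rfl
@[simp] theorem border_succ_zero (i : Fin N) : border a v A i.succ 0 = star (v i) := rfl
@[simp] theorem border_succ_succ (i j : Fin N) : border a v A i.succ j.succ = A i j := rfl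

theorem border_isHermitian {A : Matrix (Fin N) (Fin N) ℂ} (hA : A.IsHermitian) :
    (border a v A).IsHermitian := by
  ext i j
  refine Fin.cases ?_ (fun i => ?_) i <;> refine Fin.cases ?_ (fun j => ?_) j
  · simp
  · simp
  · simp
  · simpa using hA.apply i j

theorem border_mul_border_mul (U V : Matrix (Fin N) (Fin N) ℂ) :
    border 1 0 U * border a v A * border 1 0 V =
      Matrix.of (Fin.cons (Fin.cons (a : ℂ) (Matrix.vecMul v V))
        fun i => Fin.cons (Matrix.mulVec U (star v) i) ((U * A * V) i)) := by
  ext i j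
  refine Fin.cases ?_ (fun i => ?_) i <;> refine Fin.cases ?_ (fun j => ?_) j <;>
    simp [Matrix.mul_apply, Fin.sum_univ_succ, Matrix.vecMul, Matrix.mulVec, dotProduct]

theorem border_one : border 1 0 (1 : Matrix (Fin N) (Fin N) ℂ) = 1 := by
  ext i j
  refine Fin.cases ?_ (fun i => ?_) i <;> refine Fin.cases ?_ (fun j => ?_) j <;>
    simp [Matrix.one_apply, Fin.succ_ne_zero, (Fin.succ_ne_zero _).symm]

theorem border_mul_border (U V : Matrix (Fin N) (Fin N) ℂ) :
    border 1 0 U * border 1 0 V = border 1 0 (U * V) := by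
  ext i j
  refine Fin.cases ?_ (fun i => ?_) i <;> refine Fin.cases ?_ (fun j => ?_) j <;>
    simp [Matrix.mul_apply, Fin.sum_univ_succ]

theorem charpoly_conj {n : Type*} [Fintype n] [DecidableEq n] {U V : Matrix n n ℂ} (h : V * U = 1)
    (A : Matrix n n ℂ) : (U * A * V).charpoly = A.charpoly := by
  rw [Matrix.charpoly_mul_comm, ← mul_assoc, h, one_mul]

/-- Conjugating the block of a bordered matrix amounts to rotating the border. -/
theorem charpoly_border_conj {U : Matrix (Fin N) (Fin N) ℂ} (hU : star U * U = 1) :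
    (border a v (U * A * star U)).charpoly = (border a (Matrix.vecMul v U) A).charpoly := by
  have hV : border 1 0 (star U) * border 1 0 U = 1 := by
    rw [border_mul_border, hU, border_one]
  rw [← charpoly_conj hV (border a (Matrix.vecMul v U) A), border_mul_border_mul]
  have hU' : U * star U = 1 := mul_eq_one_comm.1 hU
  congr 1
  ext i j
  refine Fin.cases ?_ (fun i => ?_) i <;> refine Fin.cases ?_ (fun j => ?_) j
  · simp
  · simp [Matrix.vecMul_vecMul, hU']
  · have : Matrix.mulVec U (star (Matrix.vecMul v U)) = star v := by
      rw [Matrix.star_vecMul, Matrix.mulVec_mulVec, ← Matrix.star_eq_conjTranspose, hU',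
        Matrix.one_mulVec]
    simp [this]
  · simp

end border

/-- Schur complement of the diagonal block, which `hd` makes invertible. -/
theorem det_arrowhead {N : ℕ} {K : Type*} [Field K] (a : K) (u w d : Fin N → K)
    (hd : ∀ i, d i ≠ 0) :
    (Matrix.of (Fin.cons (Fin.cons a u) fun i => Fin.cons (w i) (Matrix.diagonal d i)) :
      Matrix (Fin (N + 1)) (Fin (N + 1)) K).det =
      a * ∏ i, d i - ∑ i, u i * w i * ∏ j ∈ Finset.univ.erase i, d j := by
  set M : Matrix (Fin (N + 1)) (Fin (N + 1)) K :=
    Matrix.of (Fin.cons (Fin.cons a u) fun i => Fin.cons (w i) (Matrix.diagonal d i)) with hM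
  -- Index 0 is sent to the second summand, so that the invertible block becomes the upper left one.
  let e : Fin N ⊕ Unit ≃ Fin (N + 1) :=
    (Equiv.optionEquivSumPUnit (Fin N)).symm.trans (finSuccEquiv N).symm
  have h1 : M.submatrix e e = Matrix.fromBlocks (Matrix.diagonal d) (Matrix.of fun i _ => w i)
      (Matrix.of fun _ j => u j) (Matrix.of fun _ _ => a) := by
    ext i j
    rcases i with i | i <;> rcases j with j | j <;> simp [e, hM]
  rw [← Matrix.det_submatrix_equiv_self e, h1]
  have hu : IsUnit (Matrix.diagonal d) := by
    rw [Matrix.isUnit_iff_isUnit_det, Matrix.det_diagonal]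
    exact (Finset.prod_ne_zero_iff.2 fun i _ => hd i).isUnit
  let _ := hu.invertible
  rw [Matrix.det_fromBlocks₁₁, Matrix.det_diagonal, Matrix.det_unique]
  have hinv : ⅟(Matrix.diagonal d) = Matrix.diagonal fun i => (d i)⁻¹ := by
    apply invOf_eq_right_inv
    rw [Matrix.diagonal_mul_diagonal]
    simp [hd]
  rw [hinv]
  simp only [Matrix.sub_apply, Matrix.of_apply, Matrix.mul_apply, Matrix.diagonal_apply, mul_ite,
    mul_zero, Finset.sum_ite_eq', Finset.mem_univ, if_true, mul_sub, Finset.mul_sum]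
  rw [mul_comm]
  congr 1
  refine Finset.sum_congr rfl fun i _ => ?_
  rw [← Finset.mul_prod_erase _ _ (Finset.mem_univ i)]
  field_simp [hd i]

open Polynomial in
/-- The polynomial `(X - a) ∏ᵢ (X - lᵢ) - ∑ᵢ rᵢ ∏_{j ≠ i} (X - lⱼ)`, the characteristic polynomial
of a bordered diagonal matrix. -/
def borderPoly {R : Type*} [CommRing R] {N : ℕ} (a : R) (r l : Fin N → R) : R[X] :=
  (X - C a) * ∏ i, (X - C (l i)) - ∑ i, C (r i) * ∏ j ∈ Finset.univ.erase i, (X - C (l j))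

-- Away from the finitely many l_i the arrowhead formula applies, and infinitely many points
-- determine a polynomial. The border enters only through its squared moduli, so its phases can be
-- integrated out.
open Polynomial in
theorem charpoly_border_diagonal {N : ℕ} (a : ℝ) (v : Fin N → ℂ) (l : Fin N → ℂ) :
    (border a v (Matrix.diagonal l)).charpoly =
      borderPoly (a : ℂ) (fun i => (Complex.normSq (v i) : ℂ)) l := by
  apply Polynomial.eq_of_infinite_eval_eq
  have hfin : (Set.range l).Finite := Set.finite_range l
  refine hfin.infinite_compl.mono fun z hz => ?_
  have hz' : ∀ i, z - l i ≠ 0 := fun i h => hz ⟨i, (sub_eq_zero.1 h).symm⟩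
  rw [Set.mem_ofPred_eq, Matrix.eval_charpoly]
  have h1 : Matrix.scalar (Fin (N + 1)) z - border a v (Matrix.diagonal l) =
      Matrix.of (Fin.cons (Fin.cons (z - a) (fun i => - v i)) fun i =>
        Fin.cons (- star (v i)) (Matrix.diagonal (fun i => z - l i) i)) := by
    ext i j
    refine Fin.cases ?_ (fun i => ?_) i <;> refine Fin.cases ?_ (fun j => ?_) j
    · simp
    · simp [(Fin.succ_ne_zero j).symm]
    · simp
    · by_cases h : i = j <;> simp [h]
  rw [h1, det_arrowhead _ _ _ _ hz']
  simp only [borderPoly, eval_sub, eval_mul, eval_X, eval_C, eval_prod, eval_finsetSum]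
  congr 1
  refine Finset.sum_congr rfl fun i _ => ?_
  rw [neg_mul_neg, ← Complex.mul_conj]
  rfl

open Polynomial in
theorem map_borderPoly {R S : Type*} [CommRing R] [CommRing S] (g : R →+* S) {N : ℕ} (a : R)
    (r l : Fin N → R) :
    (borderPoly a r l).map g = borderPoly (g a) (fun i => g (r i)) (fun i => g (l i)) := by
  simp [borderPoly, Polynomial.map_sub, Polynomial.map_mul, Polynomial.map_prod,
    Polynomial.map_sum]

/-! ### Hermitian matrices -/

theorem herm_isHermitian {N : ℕ} (a : Fin N → Fin N → ℝ) : (herm a).IsHermitian := by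
  ext i j
  rw [Matrix.conjTranspose_apply]
  rcases lt_trichotomy i j with h | rfl | h
  · simp [herm, h.ne, h.ne', h, h.not_gt, sub_eq_add_neg]
  · simp [herm]
  · simp [herm, h.ne, h.ne', h, h.not_gt, sub_eq_add_neg]

theorem continuous_herm {N : ℕ} : Continuous (herm : (Fin N → Fin N → ℝ) → _) := by
  refine continuous_matrix fun i j => ?_
  simp only [herm, Matrix.of_apply]
  split_ifs <;> fun_prop

theorem herm_diagonal {N : ℕ} (x : Fin N → ℝ) :
    herm (Matrix.diagonal x) = Matrix.diagonal fun i => (x i : ℂ) := by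
  ext i j
  by_cases h : i = j
  · subst h; simp [herm]
  · simp [herm, h, Ne.symm h]

/-- Real coordinates of a bordered Hermitian matrix. -/
def borderCoord (N : ℕ) :
    ((ℝ × (Fin N → ℂ)) × (Fin N → Fin N → ℝ)) ≃ₗ[ℝ] (Fin (N + 1) → Fin (N + 1) → ℝ) where
  toFun q := Fin.cons (Fin.cons q.1.1 fun j => (q.1.2 j).re) fun i =>
    Fin.cons (q.1.2 i).im (q.2 i)
  invFun b := ((b 0 0, fun j => ⟨b 0 j.succ, b j.succ 0⟩), fun i j => b i.succ j.succ)
  map_add' p q := by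
    ext i j
    refine Fin.cases ?_ (fun i => ?_) i <;> refine Fin.cases ?_ (fun j => ?_) j <;> simp
  map_smul' c q := by
    ext i j
    refine Fin.cases ?_ (fun i => ?_) i <;> refine Fin.cases ?_ (fun j => ?_) j <;> simp
  left_inv q := by
    refine Prod.ext (Prod.ext ?_ (funext fun j => ?_)) (funext fun i => funext fun j => ?_) <;> simp
  right_inv b := by
    ext i j
    refine Fin.cases ?_ (fun i => ?_) i <;> refine Fin.cases ?_ (fun j => ?_) j <;> simp

theorem herm_borderCoord {N : ℕ} (q : (ℝ × (Fin N → ℂ)) × (Fin N → Fin N → ℝ)) :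
    herm (borderCoord N q) = border q.1.1 q.1.2 (herm q.2) := by
  ext i j
  refine Fin.cases ?_ (fun i => ?_) i <;> refine Fin.cases ?_ (fun j => ?_) j
  · simp [herm, borderCoord]
  · have : (q.1.2 j).re + Complex.I * (q.1.2 j).im = q.1.2 j := by
      rw [mul_comm]; exact Complex.re_add_im _
    simp [herm, borderCoord, (Fin.succ_ne_zero j).symm, this]
  · simp only [herm, borderCoord, Matrix.of_apply]
    apply Complex.ext <;> simp
  · simp [herm, borderCoord]

/-- Hermitian matrices with the same characteristic polynomial are unitarily conjugate. -/
theorem exists_conj_of_charpoly_eq {n : Type*} [Fintype n] [DecidableEq n] {A B : Matrix n n ℂ}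
    (hA : A.IsHermitian) (hB : B.IsHermitian) (h : A.charpoly = B.charpoly) :
    ∃ U : Matrix n n ℂ, star U * U = 1 ∧ B = U * A * star U := by
  -- The enumerated eigenvalues coincide, so both spectral decompositions share one diagonal matrix,
  -- and the product of one eigenvector matrix with the adjoint of the other conjugates.
  have he := (hA.eigenvalues_eq_eigenvalues_iff hB).2 h
  have h1 := hA.spectral_theorem
  have h2 := hB.spectral_theorem
  rw [Unitary.conjStarAlgAut_apply] at h1 h2
  rw [← he] at h2
  set D : Matrix n n ℂ := Matrix.diagonal (RCLike.ofReal ∘ hA.eigenvalues)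
  set V : Matrix n n ℂ := hA.eigenvectorUnitary.1
  set W : Matrix n n ℂ := hB.eigenvectorUnitary.1
  have hV : star V * V = 1 := Unitary.coe_star_mul_self _
  have hV' : V * star V = 1 := Unitary.coe_mul_star_self _
  have hW : star W * W = 1 := Unitary.coe_star_mul_self _
  refine ⟨W * star V, ?_, ?_⟩
  · rw [star_mul, star_star, mul_assoc, ← mul_assoc (star W), hW, one_mul, hV']
  · conv_lhs => rw [h2]
    conv_rhs => rw [h1]
    rw [star_mul, star_star]
    calc W * D * star W = W * (star V * V) * D * (star V * V) * star W := by simp [hV]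
      _ = _ := by simp only [mul_assoc]

/-! ### Lebesgue measure in bordered coordinates -/

/-- The real determinant of a complex linear map is the squared modulus of its complex determinant,
here 1. -/
theorem measurePreserving_vecMul {N : ℕ} {U : Matrix (Fin N) (Fin N) ℂ} (hU : star U * U = 1) :
    MeasurePreserving (fun v : Fin N → ℂ => Matrix.vecMul v U) := by
  let L : (Fin N → ℂ) →ₗ[ℂ] (Fin N → ℂ) := Matrix.toLin' U.transpose
  have hL : ∀ v, L.restrictScalars ℝ v = Matrix.vecMul v U := fun v => by
    simp [L, Matrix.mulVec_transpose]
  have hdet : LinearMap.det (L.restrictScalars ℝ) = 1 := by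
    rw [LinearMap.det_restrictScalars, Algebra.norm_complex_apply, LinearMap.det_toLin',
      Matrix.det_transpose]
    have h := congrArg Matrix.det hU
    rw [Matrix.det_mul, Matrix.star_eq_conjTranspose, Matrix.det_conjTranspose, Matrix.det_one,
      mul_comm] at h
    have h' : ((Complex.normSq U.det : ℝ) : ℂ) = 1 := by
      rw [← Complex.mul_conj]; exact h
    exact_mod_cast h'
  have hmap := Measure.map_linearMap_addHaar_eq_smul_addHaar (volume : Measure (Fin N → ℂ))
    (f := L.restrictScalars ℝ) (by rw [hdet]; exact one_ne_zero)
  have hfun : (⇑(L.restrictScalars ℝ) : (Fin N → ℂ) → _) = fun v => Matrix.vecMul v U :=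
    funext hL
  rw [hdet, hfun] at hmap
  refine ⟨?_, by simpa using hmap⟩
  rw [← hfun]
  exact (LinearMap.continuous_of_finiteDimensional _).measurable

/-- Uniqueness of Haar measure. The value of c is irrelevant, since the ensembles are normalised. -/
theorem exists_volume_eq_map_borderCoord (N : ℕ) : ∃ c : ENNReal, c ≠ 0 ∧ c ≠ ⊤ ∧
    (volume : Measure (Fin (N + 1) → Fin (N + 1) → ℝ)) =
      c • Measure.map (borderCoord N) volume := by
  have hpi : ∀ k, Measure.IsAddHaarMeasure (volume : Measure (Fin k → Fin k → ℝ)) := fun k =>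
    Measure.pi.isAddHaarMeasure fun _ => volume
  have hC : Measure.IsAddHaarMeasure (volume : Measure (Fin N → ℂ)) :=
    Measure.pi.isAddHaarMeasure fun _ => volume
  have hp1 : Measure.IsAddHaarMeasure (volume : Measure (ℝ × (Fin N → ℂ))) :=
    Measure.prod.instIsAddHaarMeasure volume volume
  have hp2 : Measure.IsAddHaarMeasure
      (volume : Measure ((ℝ × (Fin N → ℂ)) × (Fin N → Fin N → ℝ))) :=
    Measure.prod.instIsAddHaarMeasure volume volume
  let e := (borderCoord N).toContinuousLinearEquiv
  have he : Measure.IsAddHaarMeasure (Measure.map e volume) :=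
    e.isAddHaarMeasure_map volume
  refine ⟨Measure.addHaarScalarFactor volume (Measure.map e volume), ?_, ENNReal.coe_ne_top, ?_⟩
  · simpa using (Measure.addHaarScalarFactor_pos_of_isAddHaarMeasure volume
      (Measure.map e volume)).ne'
  · exact Measure.isAddLeftInvariant_eq_smul volume (Measure.map e volume)

/-- The disc of radius √c has area πc, so both measures agree on the rays below c, a generating
π-system; for c ≤ 0 both give 0. -/
theorem map_normSq_volume :
    Measure.map Complex.normSq (volume : Measure ℂ) =
      ENNReal.ofReal Real.pi • volume.restrict (Set.Ioi (0 : ℝ)) := by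
  have hm : Measurable Complex.normSq := Complex.continuous_normSq.measurable
  have key : ∀ c : ℝ, Measure.map Complex.normSq (volume : Measure ℂ) (Set.Iio c) =
      ENNReal.ofReal Real.pi * ENNReal.ofReal c := fun c => by
    rw [Measure.map_apply hm measurableSet_Iio]
    have : Complex.normSq ⁻¹' Set.Iio c = Metric.ball 0 (√c) := by
      ext z
      rw [Set.mem_preimage, Set.mem_Iio, mem_ball_zero_iff, Complex.normSq_eq_norm_sq,
        Real.lt_sqrt (norm_nonneg z)]
    rw [this, Complex.volume_ball, ← ENNReal.ofReal_pow (Real.sqrt_nonneg c), mul_comm]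
    congr 1
    · simp only [ENNReal.ofReal, Real.toNNReal_of_nonneg Real.pi_pos.le]
      rfl
    rcases le_total 0 c with h | h
    · rw [Real.sq_sqrt h]
    · rw [Real.sqrt_eq_zero_of_nonpos h, ENNReal.ofReal_of_nonpos h]; simp
  refine Measure.ext_of_generateFrom_of_iUnion (Set.range Set.Iio) (fun n : ℕ => Set.Iio (n : ℝ))
    (borel_eq_generateFrom_Iio ℝ ▸ BorelSpace.measurable_eq) isPiSystem_Iio ?_ (fun n => ⟨n, rfl⟩)
    (fun n => ?_) ?_
  · exact Set.iUnion_eq_univ_iff.2 fun x => exists_nat_gt x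
  · rw [key]
    exact ENNReal.mul_ne_top ENNReal.ofReal_ne_top ENNReal.ofReal_ne_top
  · rintro _ ⟨c, rfl⟩
    rw [key, Measure.smul_apply, Measure.restrict_apply measurableSet_Iio, Set.Iio_inter_Ioi,
      Real.volume_Ioo, sub_zero, smul_eq_mul]

theorem pi_const_smul {ι α : Type*} [Fintype ι] [MeasurableSpace α] (μ : Measure α) [SigmaFinite μ]
    {c : ENNReal} (hc : c ≠ ⊤) :
    Measure.pi (fun _ : ι => c • μ) = c ^ Fintype.card ι • Measure.pi fun _ : ι => μ := by
  have : SigmaFinite (c • μ) := by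
    lift c to NNReal using hc
    exact inferInstanceAs (SigmaFinite (c • μ))
  refine Measure.pi_eq fun s _ => ?_
  simp [Finset.prod_mul_distrib, Measure.pi_pi]

theorem lintegral_normSq {N : ℕ} {g : (Fin N → ℝ) → ENNReal} (hg : Measurable g) :
    ∫⁻ v : Fin N → ℂ, g (fun i => Complex.normSq (v i)) =
      ENNReal.ofReal Real.pi ^ N * ∫⁻ r in Set.univ.pi fun _ => Set.Ioi 0, g r := by
  have hm : Measurable Complex.normSq := Complex.continuous_normSq.measurable
  have hs : SigmaFinite (ENNReal.ofReal Real.pi • volume.restrict (Set.Ioi (0 : ℝ))) := by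
    exact inferInstanceAs (SigmaFinite (Real.toNNReal Real.pi • volume.restrict (Set.Ioi (0 : ℝ))))
  have h1 : Measure.map (fun (v : Fin N → ℂ) i => Complex.normSq (v i)) volume =
      ENNReal.ofReal Real.pi ^ N • (volume.restrict (Set.univ.pi fun _ => Set.Ioi (0 : ℝ))) := by
    have : ∀ _ : Fin N, SigmaFinite (Measure.map Complex.normSq (volume : Measure ℂ)) := by
      intro _; rw [map_normSq_volume]; exact hs
    rw [volume_pi, Measure.pi_map_pi (hμ := this) fun _ => hm.aemeasurable, map_normSq_volume,
      pi_const_smul _ ENNReal.ofReal_ne_top, volume_pi, Measure.restrict_pi_pi, Fintype.card_fin]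
  rw [← lintegral_map hg (by fun_prop), h1, lintegral_smul_measure, smul_eq_mul]

/-! ### Interlacing coordinates -/

/-- The Vandermonde determinant `∏_{i<j} (xⱼ - xᵢ)`. -/
def vdet {n : ℕ} (x : Fin n → ℝ) : ℝ := (Matrix.vandermonde x).det

theorem vdet_pos {n : ℕ} {x : Fin n → ℝ} (hx : StrictMono x) : 0 < vdet x := by
  rw [vdet, Matrix.det_vandermonde]
  exact Finset.prod_pos fun i _ => Finset.prod_pos fun j hj =>
    sub_pos.2 (hx (Finset.mem_Ioi.1 hj))

theorem prod_prod_erase_abs_sub {n : ℕ} (x : Fin n → ℝ) :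
    ∏ i, ∏ j ∈ Finset.univ.erase i, |x i - x j| = vdet x ^ 2 := by
  have h := Finset.prod_prod_Ioi_mul_eq_prod_prod_off_diag fun i j : Fin n => |x j - x i|
  rw [← sq_abs, vdet, Matrix.det_vandermonde, Finset.abs_prod, ← Finset.prod_pow]
  simp only [← Finset.compl_singleton]
  rw [← h]
  refine Finset.prod_congr rfl fun i _ => ?_
  rw [Finset.abs_prod, ← Finset.prod_pow]
  refine Finset.prod_congr rfl fun j _ => ?_
  rw [abs_sub_comm (x i), sq]

/-- The points of `ℝ^(N+1)` which strictly interlace with `l`. -/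
def interlace {N : ℕ} (l : Fin N → ℝ) : Set (Fin (N + 1) → ℝ) :=
  {m | ∀ i, m i.castSucc < l i ∧ l i < m i.succ}

theorem strictMono_of_mem_interlace {N : ℕ} {l : Fin N → ℝ} {m : Fin (N + 1) → ℝ}
    (h : m ∈ interlace l) : StrictMono m :=
  Fin.strictMono_iff_lt_succ.2 fun i => (h i).1.trans (h i).2

theorem strictMono_of_mem_interlace' {N : ℕ} {l : Fin N → ℝ} {m : Fin (N + 1) → ℝ}
    (h : m ∈ interlace l) : StrictMono l := by
  cases N with
  | zero => exact Subsingleton.strictMono l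
  | succ N =>
    refine Fin.strictMono_iff_lt_succ.2 fun i => ?_
    have h1 := (h i.castSucc).2
    have h2 := (h i.succ).1
    rw [Fin.succ_castSucc] at h1
    exact h1.trans h2

/-- The corner entry and the squared moduli of the border of a matrix with eigenvalues `m` whose
lower right block is diagonal with entries `l`. -/
def borderData {N : ℕ} (l : Fin N → ℝ) (m : Fin (N + 1) → ℝ) : Fin (N + 1) → ℝ :=
  Fin.cons (∑ k, m k - ∑ i, l i) fun i =>
    -(∏ k, (l i - m k)) / ∏ j ∈ Finset.univ.erase i, (l i - l j)

/-! ### Bijection between border data and interlacing spectra -/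

section polynomial

open Polynomial

/-- At l_i every term but one vanishes. Hence the values at the points l_i determine r when the l_i
are distinct, and their signs are known when r is positive and l increasing. -/
theorem eval_borderPoly {N : ℕ} (a : ℝ) (r l : Fin N → ℝ) (i : Fin N) :
    (borderPoly a r l).eval (l i) = -(r i * ∏ j ∈ Finset.univ.erase i, (l i - l j)) := by
  simp only [borderPoly, eval_sub, eval_mul, eval_X, eval_C, eval_prod, eval_finsetSum]
  rw [Finset.prod_eq_zero (Finset.mem_univ i) (sub_self _), mul_zero, zero_sub,
    Finset.sum_eq_single i]
  · intro j _ hj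
    rw [Finset.prod_eq_zero (Finset.mem_erase.2 ⟨hj.symm, Finset.mem_univ i⟩) (sub_self _), mul_zero]
  · simp

theorem prod_erase_sub_ne_zero {N : ℕ} {l : Fin N → ℝ} (hl : Function.Injective l) (i : Fin N) :
    ∏ j ∈ Finset.univ.erase i, (l i - l j) ≠ 0 :=
  Finset.prod_ne_zero_iff.2 fun _ hj => sub_ne_zero.2 fun h => (Finset.mem_erase.1 hj).1 (hl h).symm

/-- Both products are monic of degree N+1, and their next coefficient is minus the sum of the roots,
so the two top coefficients cancel. -/
theorem degree_prod_X_sub_C_sub_lt {N : ℕ} {u v : Fin (N + 1) → ℝ} (h : ∑ k, u k = ∑ k, v k) :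
    (∏ k, (X - C (u k)) - ∏ k, (X - C (v k))).degree < (N : WithBot ℕ) := by
  have hdeg : ∀ w : Fin (N + 1) → ℝ, (∏ k, (X - C (w k))).natDegree = N + 1 := fun w => by
    simp
  have hmon : ∀ w : Fin (N + 1) → ℝ, (∏ k, (X - C (w k))).Monic := fun w =>
    monic_prod_X_sub_C _ _
  have hnext : ∀ w : Fin (N + 1) → ℝ, (∏ k, (X - C (w k))).coeff N = -∑ k, w k := fun w => by
    have := prod_X_sub_C_coeff_card_pred Finset.univ w (by simp)
    simpa using this
  rw [degree_lt_iff_coeff_zero]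
  intro k hk
  rw [coeff_sub]
  rcases hk.eq_or_lt with rfl | hk
  · rw [hnext, hnext, h, sub_self]
  rcases (Nat.succ_le_of_lt hk).eq_or_lt with rfl | hk
  · have h1 := (hmon u).coeff_natDegree
    have h2 := (hmon v).coeff_natDegree
    rw [hdeg] at h1 h2
    rw [Nat.succ_eq_add_one, h1, h2, sub_self]
  · rw [coeff_eq_zero_of_natDegree_lt (by rw [hdeg]; exact hk),
      coeff_eq_zero_of_natDegree_lt (by rw [hdeg]; exact hk), sub_self]

theorem degree_sum_C_mul_prod_erase_lt {N : ℕ} (r l : Fin N → ℝ) :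
    (∑ i, C (r i) * ∏ j ∈ Finset.univ.erase i, (X - C (l j))).degree < (N : WithBot ℕ) := by
  have hN : ∀ i : Fin N, (C (r i) * ∏ j ∈ Finset.univ.erase i, (X - C (l j))).degree < (N : WithBot ℕ) :=
    fun i => by
      rw [← smul_eq_C_mul]
      refine (degree_smul_le _ _).trans_lt ?_
      rw [degree_prod]
      simp only [degree_X_sub_C, Finset.sum_const, nsmul_eq_mul, mul_one]
      rw [Finset.card_erase_of_mem (Finset.mem_univ i), Finset.card_univ, Fintype.card_fin]
      exact_mod_cast Nat.sub_lt i.pos one_pos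
  exact (degree_sum_le _ _).trans_lt ((Finset.sup_lt_iff (WithBot.bot_lt_coe N)).2 fun i _ => hN i)

/-- Interpolation: the corner is chosen to match traces, which brings the difference below degree N,
and the squared moduli are chosen to make it vanish at the N points l_i. -/
theorem borderPoly_borderData {N : ℕ} {l : Fin N → ℝ} (hl : Function.Injective l)
    (m : Fin (N + 1) → ℝ) :
    borderPoly (borderData l m 0) (fun i => borderData l m i.succ) l = ∏ k, (X - C (m k)) := by
  refine eq_of_degree_sub_lt_of_eval_index_eq Finset.univ (v := l) hl.injOn ?_ fun i _ => ?_
  · rw [borderPoly]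
    have h1 : (X - C (borderData l m 0)) * ∏ i, (X - C (l i)) =
        ∏ k : Fin (N + 1), (X - C ((Fin.cons (borderData l m 0) l : Fin (N + 1) → ℝ) k)) := by
      rw [Fin.prod_univ_succ]; simp
    rw [h1, sub_right_comm]
    refine (degree_sub_le _ _).trans_lt (max_lt ?_ ?_)
    · rw [Finset.card_univ, Fintype.card_fin]
      apply degree_prod_X_sub_C_sub_lt
      rw [Fin.sum_univ_succ]
      simp [borderData]
    · rw [Finset.card_univ, Fintype.card_fin]
      exact degree_sum_C_mul_prod_erase_lt _ _
  · rw [eval_borderPoly, eval_prod]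
    simp only [borderData, Fin.cons_succ, eval_sub, eval_X, eval_C]
    rw [div_mul_cancel₀ _ (prod_erase_sub_ne_zero hl i), neg_neg]

theorem borderPoly_injective {N : ℕ} {l : Fin N → ℝ} (hl : Function.Injective l)
    {b c : Fin (N + 1) → ℝ} (h : borderPoly (b 0) (fun i => b i.succ) l =
      borderPoly (c 0) (fun i => c i.succ) l) : b = c := by
  have hr : ∀ i : Fin N, b i.succ = c i.succ := fun i => by
    have := congrArg (eval (l i)) h
    rw [eval_borderPoly, eval_borderPoly, neg_inj] at this
    exact mul_right_cancel₀ (prod_erase_sub_ne_zero hl i) this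
  have h0 : b 0 = c 0 := by
    simp only [borderPoly, hr] at h
    have := mul_right_cancel₀ (monic_prod_X_sub_C l Finset.univ).ne_zero (sub_left_injective h)
    simpa using this
  funext k
  exact Fin.cases h0 hr k

theorem strictMono_ext_of_prod_eq {n : ℕ} {u v : Fin n → ℝ} (hu : StrictMono u)
    (hv : StrictMono v) (h : ∏ k, (X - C (u k)) = ∏ k, (X - C (v k))) : u = v := by
  refine (StrictMono.range_inj hu hv).1 (Set.ext fun x => ?_)
  have h1 : ∀ w : Fin n → ℝ, x ∈ Set.range w ↔ (∏ k, (X - C (w k))).eval x = 0 := fun w => by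
    rw [eval_prod, Finset.prod_eq_zero_iff]
    simp [sub_eq_zero, eq_comm]
  rw [h1, h1, h]

theorem injOn_borderData {N : ℕ} {l : Fin N → ℝ} (hl : StrictMono l) :
    Set.InjOn (borderData l) (interlace l) := fun m hm m' hm' h =>
  strictMono_ext_of_prod_eq (strictMono_of_mem_interlace hm) (strictMono_of_mem_interlace hm') <| by
    rw [← borderPoly_borderData hl.injective, ← borderPoly_borderData hl.injective, h]

/-- Pair each l_j, j ≠ i, with an m on the same side of l_i: m_j if j < i, m_{j+1} if j > i. These
quotients are positive. The neighbours m_i < l_i < m_{i+1} are left over, and their product of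
differences is negative, which the minus sign corrects. -/
theorem borderData_pos {N : ℕ} {l : Fin N → ℝ} (hl : StrictMono l) {m : Fin (N + 1) → ℝ}
    (hm : m ∈ interlace l) (i : Fin N) : 0 < borderData l m i.succ := by
  have hms := strictMono_of_mem_interlace hm
  rw [borderData, Fin.cons_succ, Fin.prod_univ_succAbove _ i.castSucc,
    ← Finset.mul_prod_erase _ _ (Finset.mem_univ i), Fin.succAbove_castSucc_self, ← neg_mul,
    ← mul_assoc, mul_div_assoc, ← Finset.prod_div_distrib]
  refine mul_pos (mul_pos_of_neg_of_neg ?_ ?_) (Finset.prod_pos fun j hj => ?_)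
  · have := (hm i).1; linarith
  · have := (hm i).2; linarith
  rcases lt_or_gt_of_ne (Finset.mem_erase.1 hj).1 with h | h
  · rw [Fin.succAbove_of_castSucc_lt _ _ (by simpa using h)]
    have h1 := hl h
    have h2 := (hm j).1
    exact div_pos (by linarith) (by linarith)
  · rw [Fin.succAbove_of_le_castSucc _ _ (by simpa using h.le)]
    have h1 := hl h
    have h2 := (hm j).2
    exact div_pos_of_neg_of_neg (by linarith) (by linarith)

/-- Exactly N-1-i of the l_j exceed l_i, and these are the negative factors. -/
theorem sign_prod_erase_sub {N : ℕ} {l : Fin N → ℝ} (hl : StrictMono l) (i : Fin N) :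
    0 < (-1) ^ (N - 1 - (i : ℕ)) * ∏ j ∈ Finset.univ.erase i, (l i - l j) := by
  have h : (-1 : ℝ) ^ (N - 1 - (i : ℕ)) =
      ∏ j ∈ Finset.univ.erase i, if i < j then -1 else 1 := by
    rw [Finset.prod_ite, Finset.prod_const, Finset.prod_const_one, mul_one]
    congr 1
    rw [← Fin.card_Ioi]
    congr 1
    ext j
    simp only [Finset.mem_Ioi, Finset.mem_filter, Finset.mem_erase, Finset.mem_univ, and_true]
    exact ⟨fun h => ⟨h.ne', h⟩, fun h => h.2⟩
  rw [h, ← Finset.prod_mul_distrib]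
  refine Finset.prod_pos fun j hj => ?_
  rcases lt_or_gt_of_ne (Finset.mem_erase.1 hj).1 with h | h
  · rw [if_neg h.not_gt, one_mul]; exact sub_pos.2 (hl h)
  · rw [if_pos h]; have := hl h; linarith

theorem monic_borderPoly {N : ℕ} (a : ℝ) (r l : Fin N → ℝ) :
    (borderPoly a r l).Monic ∧ (borderPoly a r l).natDegree = N + 1 := by
  have hm : ((X - C a) * ∏ i, (X - C (l i))).Monic :=
    (monic_X_sub_C a).mul (monic_prod_X_sub_C _ _)
  have hd : ((X - C a) * ∏ i, (X - C (l i))).natDegree = N + 1 := by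
    rw [Monic.natDegree_mul (monic_X_sub_C a) (monic_prod_X_sub_C _ _)]
    simp [add_comm]
  have hlt : (∑ i, C (r i) * ∏ j ∈ Finset.univ.erase i, (X - C (l j))).degree <
      ((X - C a) * ∏ i, (X - C (l i))).degree := by
    rw [degree_eq_natDegree hm.ne_zero, hd]
    exact (degree_sum_C_mul_prod_erase_lt r l).trans (by exact_mod_cast Nat.lt_succ_self N)
  exact ⟨hm.sub_of_left hlt, by rw [borderPoly, natDegree_eq_of_degree_eq
    (degree_sub_eq_left_of_degree_lt hlt), hd]⟩

theorem exists_gt_eval_pos {P : ℝ[X]} (hP : P.Monic) (hd : 0 < P.natDegree) (B : ℝ) :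
    ∃ y > B, 0 < P.eval y := by
  have h := P.tendsto_atTop_of_leadingCoeff_nonneg (natDegree_pos_iff_degree_pos.1 hd)
    (by rw [hP.leadingCoeff]; exact zero_le_one)
  obtain ⟨y, h1, h2⟩ := ((h.eventually_gt_atTop 0).and (Filter.eventually_gt_atTop B)).exists
  exact ⟨y, h2, h1⟩

theorem exists_lt_eval_pos {P : ℝ[X]} (hP : P.Monic) (hd : 0 < P.natDegree) (B : ℝ) :
    ∃ y < B, 0 < (-1) ^ P.natDegree * P.eval y := by
  have hX : (-X : ℝ[X]).natDegree = 1 := by simp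
  have hm : (C ((-1) ^ P.natDegree) * P.comp (-X)).Monic := by
    rw [Monic, leadingCoeff_mul, leadingCoeff_C, leadingCoeff_comp (by rw [hX]; exact one_ne_zero),
      hP.leadingCoeff, leadingCoeff_neg, leadingCoeff_X, one_mul, ← mul_pow]
    simp
  have hd' : 0 < (C ((-1) ^ P.natDegree) * P.comp (-X)).natDegree := by
    rw [natDegree_C_mul (pow_ne_zero _ (by norm_num)), natDegree_comp, hX, mul_one]
    exact hd
  obtain ⟨y, hy, h⟩ := exists_gt_eval_pos hm hd' (-B)
  refine ⟨-y, by linarith, ?_⟩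
  simpa using h

/-- Every bordered diagonal matrix with nonzero border has eigenvalues interlacing with its
block. -/
theorem exists_interlace {N : ℕ} {l : Fin N → ℝ} (hl : StrictMono l) (a : ℝ) {r : Fin N → ℝ}
    (hr : ∀ i, 0 < r i) :
    ∃ m ∈ interlace l, borderPoly a r l = ∏ k, (X - C (m k)) := by
  obtain ⟨hm, hd⟩ := monic_borderPoly a r l
  set P := borderPoly a r l with hP
  obtain ⟨B, hB⟩ := (Set.finite_range l).bddAbove
  obtain ⟨B', hB'⟩ := (Set.finite_range l).bddBelow
  -- For N = 0 the bounds B and B' of the empty range are unrelated; using both on each side still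
  -- forces y₀ < y₁.
  obtain ⟨y₁, hy₁, hs₁⟩ := exists_gt_eval_pos hm (by omega) (max B B')
  obtain ⟨y₀, hy₀, hs₀⟩ := exists_lt_eval_pos hm (by omega) (min B B')
  have hlB : ∀ i, l i ≤ B := fun i => hB ⟨i, rfl⟩
  have hlB' : ∀ i, B' ≤ l i := fun i => hB' ⟨i, rfl⟩
  -- Along the N+2 increasing points y₀, l_0, …, l_{N-1}, y₁ the polynomial alternates in sign, so
  -- each of the N+1 gaps contains a root.
  let e : Fin (N + 2) → ℝ := Fin.cons y₀ (Fin.snoc l y₁ : Fin (N + 1) → ℝ)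
  have e0 : e 0 = y₀ := rfl
  have el : ∀ i : Fin N, e i.castSucc.succ = l i := fun i => by simp [e]
  have elast : e (Fin.last (N + 1)) = y₁ := by
    rw [← Fin.succ_last]; simp [e]
  have hy : y₀ < y₁ := (hy₀.trans_le min_le_max).trans hy₁
  have hlt : ∀ k : Fin (N + 1), e k.castSucc < e k.succ := by
    intro k
    refine Fin.cases ?_ (fun i => ?_) k
    · rw [Fin.castSucc_zero, e0]
      rcases N with _ | N
      · exact hy.trans_eq elast.symm
      · refine (hy₀.trans_le ((min_le_right _ _).trans (hlB' 0))).trans_eq (el 0).symm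
    · rw [← Fin.succ_castSucc, el]
      rcases N with _ | N
      · exact i.elim0
      induction i using Fin.lastCases with
      | last => exact ((hlB _).trans_lt ((le_max_left _ _).trans_lt hy₁)).trans_eq elast.symm
      | cast i =>
        rw [Fin.succ_castSucc, el]
        exact hl Fin.castSucc_lt_succ
  have hsign : ∀ k : Fin (N + 2), 0 < (-1) ^ (N + 1 - (k : ℕ)) * P.eval (e k) := by
    intro k
    refine Fin.cases ?_ (fun k => ?_) k
    · rw [hd] at hs₀
      simpa [e0] using hs₀
    · induction k using Fin.lastCases with
      | last => simpa [elast] using hs₁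
      | cast i =>
        rw [el, hP, eval_borderPoly]
        have h1 := mul_pos (hr i) (sign_prod_erase_sub hl i)
        have h2 : N + 1 - ((i.castSucc.succ : Fin (N + 2)) : ℕ) = (N - 1 - (i : ℕ)) + 1 := by
          have := i.isLt
          simp only [Fin.val_succ, Fin.val_castSucc]
          omega
        rw [h2, pow_succ]
        calc _ < _ := h1
          _ = _ := by ring
  have hroot : ∀ k : Fin (N + 1), ∃ x ∈ Set.Ioo (e k.castSucc) (e k.succ), P.eval x = 0 := by
    intro k
    have hc : ContinuousOn (fun x => (-1) ^ (N - (k : ℕ)) * P.eval x)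
        (Set.Icc (e k.castSucc) (e k.succ)) := by fun_prop
    have h1 := hsign k.castSucc
    have h2 := hsign k.succ
    have hk := k.isLt
    rw [Fin.val_castSucc, show N + 1 - (k : ℕ) = N - k + 1 by omega, pow_succ] at h1
    rw [Fin.val_succ, show N + 1 - ((k : ℕ) + 1) = N - k by omega] at h2
    obtain ⟨x, hx, h0⟩ := intermediate_value_Ioo (hlt k).le hc
      (show (0 : ℝ) ∈ Set.Ioo _ _ from ⟨by linarith, h2⟩)
    refine ⟨x, hx, ?_⟩
    simpa using h0
  choose m hmI hm0 using hroot
  have hint : m ∈ interlace l := fun i => by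
    have h1 := (hmI i.castSucc).2
    have h2 := (hmI i.succ).1
    rw [el] at h1
    rw [← Fin.succ_castSucc, el] at h2
    exact ⟨h1, h2⟩
  refine ⟨m, hint, ?_⟩
  have hinj := (strictMono_of_mem_interlace hint).injective
  -- Two monic polynomials of degree N+1 that agree at N+1 distinct points are equal.
  refine eq_of_degree_sub_lt_of_eval_index_eq Finset.univ (v := m) hinj.injOn ?_ fun k _ => ?_
  · rw [Finset.card_univ, Fintype.card_fin]
    have hq : (∏ k, (X - C (m k))).Monic := monic_prod_X_sub_C _ _
    have hqd : (∏ k, (X - C (m k))).natDegree = N + 1 := by simp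
    have h := degree_sub_lt_left (by rw [degree_eq_natDegree hm.ne_zero,
      degree_eq_natDegree hq.ne_zero, hd, hqd]) hm.ne_zero (hm.leadingCoeff.trans
      hq.leadingCoeff.symm)
    rwa [degree_eq_natDegree hm.ne_zero, hd] at h
  · rw [hm0, eval_prod, Finset.prod_eq_zero (Finset.mem_univ k)]
    simp

theorem image_borderData {N : ℕ} {l : Fin N → ℝ} (hl : StrictMono l) :
    borderData l '' interlace l = {b | ∀ i : Fin N, 0 < b i.succ} := by
  ext b
  constructor
  · rintro ⟨m, hm, rfl⟩ i
    exact borderData_pos hl hm i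
  · intro hb
    obtain ⟨m, hm, h⟩ := exists_interlace hl (b 0) hb
    exact ⟨m, hm, borderPoly_injective hl.injective ((borderPoly_borderData hl.injective m).trans
      h.symm)⟩

end polynomial

/-! ### The Jacobian of the interlacing coordinates -/

/-- The Jacobian matrix of `borderData l`. -/
def borderJac {N : ℕ} (l : Fin N → ℝ) (m : Fin (N + 1) → ℝ) : Matrix (Fin (N + 1)) (Fin (N + 1)) ℝ :=
  Matrix.of fun i k => (Fin.cons 1 fun i : Fin N => (∏ j ∈ Finset.univ.erase k, (l i - m j)) /
    ∏ j ∈ Finset.univ.erase i, (l i - l j) : Fin (N + 1) → ℝ) i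

theorem hasFDerivAt_borderData {N : ℕ} (l : Fin N → ℝ) (m : Fin (N + 1) → ℝ) :
    HasFDerivAt (borderData l) (Matrix.toLin' (borderJac l m)).toContinuousLinearMap m := by
  rw [hasFDerivAt_pi']
  intro i
  refine Fin.cases ?_ (fun i => ?_) i
  · have h : HasFDerivAt (fun m : Fin (N + 1) → ℝ => ∑ k, m k - ∑ i, l i)
        (∑ k, ContinuousLinearMap.proj (R := ℝ) k) m :=
      (HasFDerivAt.fun_sum fun k _ => hasFDerivAt_apply k m).sub_const _
    convert! h using 1
    ext v
    simp [borderJac, Matrix.mulVec, dotProduct]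
  · have h : HasFDerivAt (fun m : Fin (N + 1) → ℝ => ∏ k, (l i - m k))
        (∑ k, (∏ j ∈ Finset.univ.erase k, (l i - m j)) •
          (-ContinuousLinearMap.proj (R := ℝ) (φ := fun _ => ℝ) k)) m :=
      HasFDerivAt.finsetProd fun k _ => (hasFDerivAt_apply k m).const_sub _
    have h' := (h.neg).mul_const (∏ j ∈ Finset.univ.erase i, (l i - l j))⁻¹
    convert! h' using 1
    ext v
    simp only [borderJac, ContinuousLinearMap.comp_apply, LinearMap.coe_toContinuousLinearMap',
      Matrix.toLin'_apply, Matrix.mulVec, dotProduct, Matrix.of_apply, Fin.cons_succ,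
      ContinuousLinearMap.proj_apply, smul_neg, Finset.sum_neg_distrib, neg_neg,
      smul_apply, sum_apply, smul_eq_mul, Finset.mul_sum,
      div_eq_mul_inv]
    exact Finset.sum_congr rfl fun k _ => by ring

-- The entries are values at l_i of Q_k = ∏_{j≠k}(X - m_j), up to row scaling; the first row is the
-- leading coefficient of Q_k. So the Jacobian factors as row scaling times evaluation times the
-- coefficient matrix, with absolute determinants Δ(l)⁻², Δ(l) and Δ(m).
open Polynomial in
theorem abs_det_borderJac {N : ℕ} {l : Fin N → ℝ} {m : Fin (N + 1) → ℝ} (hl : StrictMono l)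
    (hm : StrictMono m) : |(borderJac l m).det| = vdet m / vdet l := by
  let Q : Fin (N + 1) → ℝ[X] := fun k => ∏ j ∈ Finset.univ.erase k, (X - C (m j))
  have hQm : ∀ k, (Q k).Monic := fun k => monic_prod_X_sub_C _ _
  have hQd : ∀ k, (Q k).natDegree = N := fun k => by
    simp only [Q]
    rw [natDegree_prod_of_monic _ _ fun j _ => monic_X_sub_C _]
    simp [Finset.card_erase_of_mem]
  have hQe : ∀ k x, (Q k).eval x = ∑ j : Fin (N + 1), (Q k).coeff j * x ^ (j : ℕ) := fun k x => by
    rw [eval_eq_sum_range' (n := N + 1) (by rw [hQd]; exact Nat.lt_succ_self N),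
      Finset.sum_range]
  let G : Matrix (Fin (N + 1)) (Fin (N + 1)) ℝ := Matrix.of fun j k => (Q k).coeff j
  let B : Matrix (Fin (N + 1)) (Fin (N + 1)) ℝ := Matrix.of fun i j =>
    (Fin.cons (if j = Fin.last N then 1 else 0) fun i : Fin N => l i ^ (j : ℕ) : Fin (N + 1) → ℝ) i
  let d : Fin (N + 1) → ℝ :=
    Fin.cons 1 fun i : Fin N => (∏ j ∈ Finset.univ.erase i, (l i - l j))⁻¹
  have hJ : borderJac l m = Matrix.diagonal d * (B * G) := by
    ext i k
    rw [Matrix.diagonal_mul, Matrix.mul_apply]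
    refine Fin.cases ?_ (fun i => ?_) i
    · have h1 := (hQm k).coeff_natDegree
      rw [hQd] at h1
      simp [borderJac, d, B, G, h1]
    · have h1 := hQe k (l i)
      simp only [Q, eval_prod, eval_sub, eval_X, eval_C] at h1
      simp only [borderJac, Matrix.of_apply, Fin.cons_succ, d, B, G]
      rw [h1, div_eq_inv_mul]
      simp only [Q, mul_comm (l i ^ _)]
  -- Q_k vanishes at all m_i with i ≠ k. The diagonal has absolute determinant Δ(m)², which leaves
  -- Δ(m) for G.
  have hV : Matrix.vandermonde m * G = Matrix.diagonal fun k => (Q k).eval (m k) := by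
    ext i k
    rw [Matrix.mul_apply, Matrix.diagonal_apply]
    have h1 := hQe k (m i)
    simp only [Matrix.vandermonde_apply, G, Matrix.of_apply, mul_comm (m i ^ _)]
    rw [← h1]
    split_ifs with h
    · rw [h]
    · simp only [Q, eval_prod, eval_sub, eval_X, eval_C]
      exact Finset.prod_eq_zero (Finset.mem_erase.2 ⟨h, Finset.mem_univ i⟩) (sub_self _)
  have hG : |G.det| = vdet m := by
    have h1 := congrArg (fun M => |Matrix.det M|) hV
    simp only [Matrix.det_mul, Matrix.det_diagonal, abs_mul, Finset.abs_prod, Q, eval_prod, eval_sub,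
      eval_X, eval_C, prod_prod_erase_abs_sub] at h1
    have hp := vdet_pos hm
    change |vdet m| * _ = _ at h1
    rw [abs_of_pos hp, sq] at h1
    exact mul_left_cancel₀ hp.ne' h1
  have hB : |B.det| = vdet l := by
    rw [Matrix.det_succ_row_zero, Finset.sum_eq_single (Fin.last N)]
    · have : B.submatrix Fin.succ (Fin.last N).succAbove = Matrix.vandermonde l := by
        ext i j
        simp [B, Matrix.vandermonde_apply]
      rw [this, abs_mul, abs_mul, abs_pow]
      change _ * |vdet l| = _
      rw [abs_of_pos (vdet_pos hl)]
      simp [B]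
    · intro j _ hj
      simp [B, hj]
    · simp
  have hd : |∏ i, d i| = (vdet l ^ 2)⁻¹ := by
    rw [Fin.prod_univ_succ, ← prod_prod_erase_abs_sub]
    simp [d, abs_inv, Finset.abs_prod]
  have hp := vdet_pos hl
  rw [hJ, Matrix.det_mul, Matrix.det_mul, Matrix.det_diagonal, abs_mul, abs_mul, hG, hB, hd]
  field_simp

theorem measurableSet_interlace_prod {N : ℕ} :
    MeasurableSet {q : (Fin N → ℝ) × (Fin (N + 1) → ℝ) | q.2 ∈ interlace q.1} := by
  have : {q : (Fin N → ℝ) × (Fin (N + 1) → ℝ) | q.2 ∈ interlace q.1} =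
      ⋂ i, ({q | q.2 (Fin.castSucc i) < q.1 i} ∩ {q | q.1 i < q.2 (Fin.succ i)}) := by
    ext q; simp [interlace]
  rw [this]
  exact MeasurableSet.iInter fun i =>
    (measurableSet_lt (by fun_prop) (by fun_prop)).inter
      (measurableSet_lt (by fun_prop) (by fun_prop))

theorem measurableSet_interlace {N : ℕ} (l : Fin N → ℝ) : MeasurableSet (interlace l) :=
  measurable_prodMk_left measurableSet_interlace_prod

/-- Integration over the border of a diagonal matrix in terms of the eigenvalues. -/
theorem lintegral_borderData {N : ℕ} {l : Fin N → ℝ} (hl : StrictMono l)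
    (g : (Fin (N + 1) → ℝ) → ENNReal) :
    ∫⁻ b in {b : Fin (N + 1) → ℝ | ∀ i : Fin N, 0 < b i.succ}, g b =
      ∫⁻ m in interlace l, ENNReal.ofReal (vdet m / vdet l) * g (borderData l m) := by
  rw [← image_borderData hl, lintegral_image_eq_lintegral_abs_det_fderiv_mul volume
    (measurableSet_interlace l) (fun m _ => (hasFDerivAt_borderData l m).hasFDerivWithinAt)
    (injOn_borderData hl)]
  refine setLIntegral_congr_fun (measurableSet_interlace l) fun m hm => ?_
  have hdet : (Matrix.toLin' (borderJac l m)).toContinuousLinearMap.det = (borderJac l m).det := by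
    rw [ContinuousLinearMap.det, LinearMap.coe_toContinuousLinearMap, LinearMap.det_toLin']
  simp only [hdet]
  rw [abs_det_borderJac hl (strictMono_of_mem_interlace hm)]

/-! ### Integration of determinants -/

theorem integrable_prod_mul {ι α : Type*} [Fintype ι] [MeasurableSpace α]
    {μ : ι → Measure α} [∀ i, SigmaFinite (μ i)] {f : ι → ι → α → ℝ}
    (hf : ∀ i j, Integrable (f i j) (μ i)) (σ : Equiv.Perm ι) :
    Integrable (fun x : ι → α => ∏ i, f i (σ i) (x i)) (Measure.pi μ) :=
  Integrable.fintype_prod fun i => hf i (σ i)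

/-- Each variable occurs in one row only, so every term of the Leibniz expansion factors under the
product measure. -/
theorem integral_det_pi {ι α : Type*} [Fintype ι] [DecidableEq ι] [MeasurableSpace α]
    {μ : ι → Measure α} [∀ i, SigmaFinite (μ i)] {f : ι → ι → α → ℝ}
    (hf : ∀ i j, Integrable (f i j) (μ i)) :
    Integrable (fun x : ι → α => (Matrix.of fun i j => f i j (x i)).det) (Measure.pi μ) ∧
    ∫ x, (Matrix.of fun i j => f i j (x i)).det ∂Measure.pi μ =
      (Matrix.of fun i j => ∫ y, f i j y ∂μ i).det := by
  have h : ∀ M : Matrix ι ι ℝ, M.det = ∑ σ : Equiv.Perm ι, (Equiv.Perm.sign σ : ℝ) * ∏ i, M i (σ i) :=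
    fun M => by rw [← Matrix.det_transpose, Matrix.det_apply']; rfl
  simp only [h, Matrix.of_apply]
  have hi : ∀ σ ∈ (Finset.univ : Finset (Equiv.Perm ι)), Integrable (fun x : ι → α =>
      ((Equiv.Perm.sign σ : ℤ) : ℝ) * ∏ i, f i (σ i) (x i)) (Measure.pi μ) := fun σ _ =>
    (integrable_prod_mul hf σ).const_mul _
  refine ⟨integrable_finsetSum _ hi, ?_⟩
  rw [integral_finsetSum _ hi]
  refine Finset.sum_congr rfl fun σ _ => ?_
  rw [integral_const_mul, integral_fintype_prod_eq_prod fun i => f i (σ i)]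

/-- For fixed m the l_i range independently over the gaps (m_i, m_{i+1}), so the Vandermonde
determinant is integrated row by row. The factors 1/(j+1) from the columns give 1/N!, and the
differences of powers that remain form the Vandermonde determinant of m after row operations. -/
theorem integral_vdet_interlace {N : ℕ} {m : Fin (N + 1) → ℝ} (hm : StrictMono m) :
    ∫⁻ l in {l | m ∈ interlace l}, ENNReal.ofReal (vdet l) =
      ENNReal.ofReal ((N.factorial : ℝ)⁻¹ * vdet m) := by
  have hset : {l | m ∈ interlace l} = Set.univ.pi fun i : Fin N => Set.Ioo (m i.castSucc) (m i.succ) := by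
    ext l; simp [interlace]
  have hle : ∀ i : Fin N, m i.castSucc ≤ m i.succ := fun i => (hm Fin.castSucc_lt_succ).le
  have hf : ∀ i j : Fin N, Integrable (fun x : ℝ => x ^ (j : ℕ))
      (volume.restrict (Set.Ioo (m i.castSucc) (m i.succ))) := fun i j =>
    (continuous_pow (j : ℕ)).continuousOn.integrableOn_Icc.mono_set Set.Ioo_subset_Icc_self
  obtain ⟨h1, h2⟩ := integral_det_pi hf
  have hpi : (volume : Measure (Fin N → ℝ)).restrict {l | m ∈ interlace l} =
      Measure.pi fun i : Fin N => volume.restrict (Set.Ioo (m i.castSucc) (m i.succ)) := by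
    rw [hset, volume_pi, Measure.restrict_pi_pi]
  rw [← hpi] at h1 h2
  have hms : MeasurableSet {l | m ∈ interlace l} := by
    rw [hset]; exact MeasurableSet.univ_pi fun i => measurableSet_Ioo
  have h1' : Integrable (fun l : Fin N → ℝ => vdet l) (volume.restrict {l | m ∈ interlace l}) := h1
  rw [← ofReal_integral_eq_lintegral_ofReal h1']
  swap
  · refine (ae_restrict_iff' hms).2 (Filter.Eventually.of_forall fun l hl => ?_)
    exact (vdet_pos (strictMono_of_mem_interlace' hl)).le
  congr 1
  refine h2.trans ?_
  have h3 : ∀ i j : Fin N, ∫ x in Set.Ioo (m i.castSucc) (m i.succ), x ^ (j : ℕ) =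
      ((j : ℝ) + 1)⁻¹ * (m i.succ ^ ((j : ℕ) + 1) - m i.castSucc ^ ((j : ℕ) + 1)) := fun i j => by
    rw [← integral_Ioc_eq_integral_Ioo, ← intervalIntegral.integral_of_le (hle i), integral_pow]
    rw [div_eq_inv_mul]
  simp only [h3]
  have h4 := Matrix.det_mul_row (fun j : Fin N => ((j : ℝ) + 1)⁻¹)
    (Matrix.of fun i j : Fin N => m i.succ ^ ((j : ℕ) + 1) - m i.castSucc ^ ((j : ℕ) + 1))
  refine h4.trans ?_
  have hfac : ∏ j : Fin N, ((j : ℝ) + 1)⁻¹ = (N.factorial : ℝ)⁻¹ := by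
    rw [Finset.prod_inv_distrib, ← Finset.prod_range_add_one_eq_factorial, Finset.prod_range]
    push_cast; rfl
  rw [hfac]
  congr 1
  -- The Vandermonde matrix of m with each row's predecessor subtracted; its first column is (1, 0,
  -- …, 0).
  let W : Matrix (Fin (N + 1)) (Fin (N + 1)) ℝ := Matrix.of fun i j =>
    (Fin.cons (m 0 ^ (j : ℕ)) fun i : Fin N => m i.succ ^ (j : ℕ) - m i.castSucc ^ (j : ℕ) :
      Fin (N + 1) → ℝ) i
  have h5 : vdet m = W.det := by
    refine Matrix.det_eq_of_forall_row_eq_smul_add_pred (fun _ => 1) (fun j => ?_) fun i j => ?_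
    · simp [W, Matrix.vandermonde_apply]
    · simp [W, Matrix.vandermonde_apply]
  rw [h5, Matrix.det_succ_column_zero, Finset.sum_eq_single 0]
  · simp only [W, Matrix.of_apply]
    simp
    rfl
  · intro i _ hi
    obtain ⟨i, rfl⟩ := Fin.exists_succ_eq.2 hi
    simp [W]
  · simp

/-! ### The Weyl integration formula -/

theorem exists_herm_eq {N : ℕ} {A : Matrix (Fin N) (Fin N) ℂ} (hA : A.IsHermitian) :
    ∃ a, herm a = A := by
  refine ⟨fun i j => if i ≤ j then (A i j).re else (A j i).im, ?_⟩
  ext i j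
  have h := hA.apply i j
  rcases lt_trichotomy i j with hij | rfl | hij
  · simp only [herm, Matrix.of_apply, if_neg hij.ne, if_pos hij, if_pos hij.le, if_neg hij.not_ge]
    rw [mul_comm]; exact Complex.re_add_im _
  · simp only [herm, Matrix.of_apply, if_true, le_refl]
    exact Complex.conj_eq_iff_re.1 h
  · simp only [herm, Matrix.of_apply, if_neg hij.ne', if_neg hij.not_gt, if_pos hij.le,
      if_neg hij.not_ge]
    rw [← h]
    apply Complex.ext <;> simp

theorem continuous_vdet {n : ℕ} : Continuous (vdet : (Fin n → ℝ) → ℝ) := by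
  unfold vdet
  simp only [Matrix.det_vandermonde]
  fun_prop

/-- Measurability of f is assumed only through `herm`, so the diagonal matrix has to be written in
these coordinates. -/
theorem measurable_comp_diagonal {N : ℕ} {f : Matrix (Fin N) (Fin N) ℂ → ENNReal}
    (hf : Measurable fun a => f (herm a)) :
    Measurable fun x : Fin N → ℝ => f (Matrix.diagonal fun i => (x i : ℂ)) := by
  simp only [← herm_diagonal]
  refine hf.comp ?_
  refine measurable_pi_lambda _ fun i => measurable_pi_lambda _ fun j => ?_
  simp only [Matrix.diagonal_apply]
  split_ifs <;> fun_prop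

theorem measurable_comp_border {N : ℕ} {f : Matrix (Fin (N + 1)) (Fin (N + 1)) ℂ → ENNReal}
    (hf : Measurable fun a => f (herm a)) :
    Measurable fun q : (ℝ × (Fin N → ℂ)) × (Fin N → Fin N → ℝ) =>
      f (border q.1.1 q.1.2 (herm q.2)) := by
  simp only [← herm_borderCoord]
  exact hf.comp (borderCoord N).toContinuousLinearEquiv.continuous.measurable

/-- A function of Hermitian matrices which depends only on the characteristic polynomial. -/
def IsClassFun {N : ℕ} {α : Type*} (f : Matrix (Fin N) (Fin N) ℂ → α) : Prop :=
  ∀ A B, A.IsHermitian → B.IsHermitian → A.charpoly = B.charpoly → f A = f B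

/-- Conjugating the block is undone by a unitary rotation of the border, which preserves Lebesgue
measure. This lets the induction hypothesis act on the block. -/
theorem IsClassFun.lintegral_border {N : ℕ} {f : Matrix (Fin (N + 1)) (Fin (N + 1)) ℂ → ENNReal}
    (hf : IsClassFun f) (hm : Measurable fun a => f (herm a)) :
    IsClassFun fun A => ∫⁻ p : ℝ × (Fin N → ℂ), f (border p.1 p.2 A) := by
  intro A B hA hB h
  obtain ⟨U, hU, rfl⟩ := exists_conj_of_charpoly_eq hA hB h
  obtain ⟨α, rfl⟩ := exists_herm_eq hA
  have hrot := (MeasurePreserving.id (volume : Measure ℝ)).prod (measurePreserving_vecMul hU)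
  have hmeas : Measurable fun p : ℝ × (Fin N → ℂ) => f (border p.1 p.2 (herm α)) :=
    (measurable_comp_border hm).comp measurable_prodMk_right
  refine (hrot.lintegral_comp hmeas).symm.trans (lintegral_congr fun p => ?_)
  exact (hf _ _ (border_isHermitian _ _ hB) (border_isHermitian _ _ hA)
    (charpoly_border_conj _ _ _ hU)).symm

theorem lintegral_cons {N : ℕ} {k : (Fin (N + 1) → ℝ) → ENNReal} (hk : Measurable k) :
    ∫⁻ a, ∫⁻ r in Set.univ.pi fun _ : Fin N => Set.Ioi 0, k (Fin.cons a r) =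
      ∫⁻ b in {b | ∀ i : Fin N, 0 < b i.succ}, k b := by
  have hS : MeasurableSet {b : Fin (N + 1) → ℝ | ∀ i : Fin N, 0 < b i.succ} := by
    have : {b : Fin (N + 1) → ℝ | ∀ i : Fin N, 0 < b i.succ} =
        ⋂ i : Fin N, {b | 0 < b i.succ} := by ext; simp
    rw [this]
    exact MeasurableSet.iInter fun i => measurableSet_lt measurable_const (measurable_pi_apply _)
  have hmp := (volume_preserving_piFinSuccAbove (fun _ : Fin (N + 1) => ℝ) 0).symm
  rw [← lintegral_indicator hS, ← hmp.lintegral_comp (hk.indicator hS), Measure.volume_eq_prod,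
    lintegral_prod (fun z => Set.indicator _ k
      ((MeasurableEquiv.piFinSuccAbove (fun _ => ℝ) 0).symm z))
      (((hk.indicator hS).comp hmp.measurable).aemeasurable)]
  refine lintegral_congr fun a => ?_
  rw [← lintegral_indicator (MeasurableSet.univ_pi fun _ => measurableSet_Ioi)]
  refine lintegral_congr fun r => ?_
  have hcons : (MeasurableEquiv.piFinSuccAbove (fun _ : Fin (N + 1) => ℝ) 0).symm (a, r) =
      Fin.cons a r := by
    ext i
    exact Fin.cases rfl (fun _ => rfl) i
  rw [hcons]
  simp [Set.indicator]

/-- The integrand depends on v only through |v_i|². Passing to squared moduli costs π^N, and passing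
from these to the eigenvalues costs Δ(m)/Δ(l). -/
theorem lintegral_border_diagonal {N : ℕ} {f : Matrix (Fin (N + 1)) (Fin (N + 1)) ℂ → ENNReal}
    (hf : IsClassFun f) (hm : Measurable fun a => f (herm a)) {l : Fin N → ℝ} (hl : StrictMono l) :
    ∫⁻ p : ℝ × (Fin N → ℂ), f (border p.1 p.2 (Matrix.diagonal fun i => (l i : ℂ))) =
      ENNReal.ofReal Real.pi ^ N * ∫⁻ m in interlace l, ENNReal.ofReal (vdet m / vdet l) *
        f (Matrix.diagonal fun i => (m i : ℂ)) := by
  set D := Matrix.diagonal fun i => (l i : ℂ) with hD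
  have hDh : D.IsHermitian := by rw [hD, ← herm_diagonal]; exact herm_isHermitian _
  -- A representative border with the prescribed squared moduli; its values at negative b_i, where
  -- the root is 0, play no role.
  let k : (Fin (N + 1) → ℝ) → ENNReal := fun b =>
    f (border (b 0) (fun i => ((√(b i.succ) : ℝ) : ℂ)) D)
  have hk : Measurable k := by
    have h := (measurable_comp_border hm).comp (f := fun b : Fin (N + 1) → ℝ =>
      (((b 0, fun i => ((√(b i.succ) : ℝ) : ℂ)), Matrix.diagonal l) :
        (ℝ × (Fin N → ℂ)) × (Fin N → Fin N → ℝ))) (by fun_prop)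
    simpa only [Function.comp_def, herm_diagonal] using! h
  have hkb : ∀ (b : Fin (N + 1) → ℝ), (∀ i : Fin N, 0 ≤ b i.succ) → ∀ B : Matrix _ _ ℂ,
      B.IsHermitian → B.charpoly = borderPoly (b 0 : ℂ) (fun i => (b i.succ : ℂ))
        (fun i => (l i : ℂ)) → f B = k b := fun b hb B hB h => by
    refine hf _ _ hB (border_isHermitian _ _ hDh) ?_
    rw [h, hD, charpoly_border_diagonal]
    congr 1
    funext i
    rw [Complex.normSq_ofReal, Real.mul_self_sqrt (hb i)]
  have h1 : ∀ (a : ℝ) (v : Fin N → ℂ), f (border a v D) =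
      k (Fin.cons a fun i => Complex.normSq (v i)) := fun a v =>
    hkb (Fin.cons a fun i => Complex.normSq (v i)) (fun i => Complex.normSq_nonneg _) _
      (border_isHermitian _ _ hDh) (charpoly_border_diagonal _ _ _)
  have hmeas : Measurable fun p : ℝ × (Fin N → ℂ) => k (Fin.cons p.1 fun i => Complex.normSq (p.2 i)) := by
    refine hk.comp (measurable_pi_lambda _ fun i => ?_)
    have : Measurable Complex.normSq := Complex.continuous_normSq.measurable
    refine Fin.cases ?_ (fun i => ?_) i
    · simpa using measurable_fst
    · simp only [Fin.cons_succ]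
      fun_prop
  have hcm : ∀ a : ℝ, Measurable fun r : Fin N → ℝ => k (Fin.cons a r) := fun a => by
    refine hk.comp (measurable_pi_lambda _ fun i => ?_)
    refine Fin.cases ?_ (fun i => ?_) i
    · simp
    · simp only [Fin.cons_succ]
      fun_prop
  simp only [h1]
  rw [Measure.volume_eq_prod, lintegral_prod _ hmeas.aemeasurable]
  have h2 : ∀ a : ℝ, ∫⁻ v : Fin N → ℂ, k (Fin.cons a fun i => Complex.normSq (v i)) =
      ENNReal.ofReal Real.pi ^ N * ∫⁻ r in Set.univ.pi fun _ => Set.Ioi 0, k (Fin.cons a r) :=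
    fun a => lintegral_normSq (hcm a)
  simp only [h2]
  rw [lintegral_const_mul' _ _ (ENNReal.pow_ne_top ENNReal.ofReal_ne_top), lintegral_cons hk,
    lintegral_borderData hl]
  congr 1
  refine setLIntegral_congr_fun (measurableSet_interlace l) fun m hm' => ?_
  congr 1
  refine (hkb _ (fun i => (borderData_pos hl hm' i).le) _ ?_ ?_).symm
  · rw [← herm_diagonal]; exact herm_isHermitian _
  · rw [Matrix.charpoly_diagonal]
    have h3 := congrArg (Polynomial.map Complex.ofRealHom) (borderPoly_borderData hl.injective m)
    rw [map_borderPoly] at h3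
    simp only [Polynomial.map_prod, Polynomial.map_sub, Polynomial.map_X, Polynomial.map_C] at h3
    exact h3.symm

theorem measurableSet_strictMono (N : ℕ) : MeasurableSet {x : Fin N → ℝ | StrictMono x} := by
  have : {x : Fin N → ℝ | StrictMono x} = ⋂ (i) (j) (_ : i < j), {x | x i < x j} := by
    ext x; simp [StrictMono]
  rw [this]
  exact MeasurableSet.iInter fun i => MeasurableSet.iInter fun j => MeasurableSet.iInter fun _ =>
    measurableSet_lt (by fun_prop) (by fun_prop)

/-- Tonelli on the set of interlacing pairs, where both tuples are automatically increasing. The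
weight there is Δ(l)Δ(m), and the inner integral over l yields the second Δ(m). -/
theorem lintegral_interlace_swap {N : ℕ} {h : (Fin (N + 1) → ℝ) → ENNReal} (hh : Measurable h) :
    ∫⁻ l in {l : Fin N → ℝ | StrictMono l}, ENNReal.ofReal (vdet l ^ 2) *
        ∫⁻ m in interlace l, ENNReal.ofReal (vdet m / vdet l) * h m =
      ENNReal.ofReal (N.factorial : ℝ)⁻¹ *
        ∫⁻ m in {m : Fin (N + 1) → ℝ | StrictMono m}, ENNReal.ofReal (vdet m ^ 2) * h m := by
  let T := {q : (Fin N → ℝ) × (Fin (N + 1) → ℝ) | q.2 ∈ interlace q.1}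
  have hT : MeasurableSet T := measurableSet_interlace_prod
  let K : (Fin N → ℝ) × (Fin (N + 1) → ℝ) → ENNReal :=
    T.indicator fun q => ENNReal.ofReal (vdet q.1) * (ENNReal.ofReal (vdet q.2) * h q.2)
  have hV : ∀ n, Measurable (vdet : (Fin n → ℝ) → ℝ) := fun n => continuous_vdet.measurable
  have hK : Measurable K := by
    refine Measurable.indicator ?_ hT
    have h1 := hV N
    have h2 := hV (N + 1)
    fun_prop
  have hL : ∫⁻ l in {l : Fin N → ℝ | StrictMono l}, ENNReal.ofReal (vdet l ^ 2) *
      ∫⁻ m in interlace l, ENNReal.ofReal (vdet m / vdet l) * h m = ∫⁻ l, ∫⁻ m, K (l, m) := by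
    rw [← lintegral_indicator (measurableSet_strictMono N)]
    refine lintegral_congr fun l => ?_
    by_cases hl : StrictMono l
    · have hp := vdet_pos hl
      rw [Set.indicator_of_mem (by exact hl), ← lintegral_const_mul' _ _ ENNReal.ofReal_ne_top,
        ← lintegral_indicator (measurableSet_interlace l)]
      refine lintegral_congr fun m => ?_
      by_cases hm : m ∈ interlace l
      · have hK' : K (l, m) = ENNReal.ofReal (vdet l) * (ENNReal.ofReal (vdet m) * h m) :=
          Set.indicator_of_mem (s := T) hm _
        rw [hK', Set.indicator_of_mem hm, ← mul_assoc, ← mul_assoc,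
          ← ENNReal.ofReal_mul (sq_nonneg _), ← ENNReal.ofReal_mul hp.le]
        congr 2
        field_simp
      · have hK' : K (l, m) = 0 := Set.indicator_of_notMem (s := T) hm _
        rw [hK', Set.indicator_of_notMem hm]
    · rw [Set.indicator_of_notMem (by exact hl)]
      have hK' : ∀ m, K (l, m) = 0 := fun m =>
        Set.indicator_of_notMem (s := T) (fun hm => hl (strictMono_of_mem_interlace' hm)) _
      simp [hK']
  have hR : ∫⁻ m, ∫⁻ l, K (l, m) = ENNReal.ofReal (N.factorial : ℝ)⁻¹ *
        ∫⁻ m in {m : Fin (N + 1) → ℝ | StrictMono m}, ENNReal.ofReal (vdet m ^ 2) * h m := by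
    rw [← lintegral_const_mul' _ _ ENNReal.ofReal_ne_top,
      ← lintegral_indicator (measurableSet_strictMono _)]
    refine lintegral_congr fun m => ?_
    have hTm : MeasurableSet {l | m ∈ interlace l} := measurable_prodMk_right hT
    by_cases hm : StrictMono m
    · rw [Set.indicator_of_mem (by exact hm)]
      have hK' : ∀ l, K (l, m) = {l | m ∈ interlace l}.indicator
          (fun l => ENNReal.ofReal (vdet l)) l * (ENNReal.ofReal (vdet m) * h m) := fun l => by
        by_cases hl : m ∈ interlace l
        · rw [Set.indicator_of_mem (by exact hl)]
          exact Set.indicator_of_mem (s := T) hl _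
        · rw [Set.indicator_of_notMem (by exact hl), zero_mul]
          exact Set.indicator_of_notMem (s := T) hl _
      simp only [hK']
      rw [lintegral_mul_const _ (((hV N).ennreal_ofReal).indicator hTm), lintegral_indicator hTm,
        integral_vdet_interlace hm, ← mul_assoc, ← mul_assoc,
        ← ENNReal.ofReal_mul (mul_nonneg (by positivity) (vdet_pos hm).le),
        ← ENNReal.ofReal_mul (by positivity)]
      congr 2
      ring
    · rw [Set.indicator_of_notMem (by exact hm)]
      have hK' : ∀ l, K (l, m) = 0 := fun l =>
        Set.indicator_of_notMem (s := T) (fun hl => hm (strictMono_of_mem_interlace hl)) _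
      simp [hK']
  rw [hL, ← hR]
  exact lintegral_lintegral_swap hK.aemeasurable

/-- The **Weyl integration formula** for Hermitian matrices, up to the value of the constant. -/
theorem exists_lintegral_herm_eq (N : ℕ) : ∃ c : ENNReal, c ≠ 0 ∧ c ≠ ⊤ ∧
    ∀ f : Matrix (Fin N) (Fin N) ℂ → ENNReal, IsClassFun f → (Measurable fun a => f (herm a)) →
      ∫⁻ a, f (herm a) = c * ∫⁻ x in {x : Fin N → ℝ | StrictMono x},
        ENNReal.ofReal (vdet x ^ 2) * f (Matrix.diagonal fun i => (x i : ℂ)) := by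
  induction N with
  | zero =>
    refine ⟨1, one_ne_zero, ENNReal.one_ne_top, fun f _ _ => ?_⟩
    have h1 : ∀ A : Matrix (Fin 0) (Fin 0) ℂ, f A = f 1 := fun A => by
      rw [Subsingleton.elim A 1]
    have h2 : {x : Fin 0 → ℝ | StrictMono x} = Set.univ :=
      Set.eq_univ_of_forall fun x => Subsingleton.strictMono x
    have h3 : ∀ x : Fin 0 → ℝ, vdet x = 1 := fun x => by simp [vdet]
    simp [h1, h2, h3, volume_pi]
  | succ N ih =>
    obtain ⟨c, hc0, hct, hc⟩ := ih
    obtain ⟨c', hc0', hct', hc'⟩ := exists_volume_eq_map_borderCoord N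
    refine ⟨c' * (c * (ENNReal.ofReal Real.pi ^ N * ENNReal.ofReal (N.factorial : ℝ)⁻¹)), ?_, ?_,
      fun f hf hm => ?_⟩
    · have := Real.pi_pos
      refine mul_ne_zero hc0' (mul_ne_zero hc0 (mul_ne_zero (pow_ne_zero _ ?_) ?_))
      · simpa using this
      · simpa using Nat.factorial_ne_zero N
    · exact ENNReal.mul_ne_top hct' (ENNReal.mul_ne_top hct (ENNReal.mul_ne_top
        (ENNReal.pow_ne_top ENNReal.ofReal_ne_top) ENNReal.ofReal_ne_top))
    have hbm := measurable_comp_border hm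
    -- The induction hypothesis is applied to the integral over the border, as a function of the
    -- block.
    have hG := hc _ (hf.lintegral_border hm) (Measurable.lintegral_prod_left' hbm)
    have hcont : Measurable (borderCoord N) :=
      (borderCoord N).toContinuousLinearEquiv.continuous.measurable
    rw [hc', lintegral_smul_measure, lintegral_map hm hcont]
    simp only [herm_borderCoord, smul_eq_mul]
    rw [Measure.volume_eq_prod, lintegral_prod_symm _ hbm.aemeasurable, hG]
    rw [setLIntegral_congr_fun (measurableSet_strictMono N) fun l hl => by
      rw [lintegral_border_diagonal hf hm hl, mul_left_comm]]
    rw [lintegral_const_mul' _ _ (ENNReal.pow_ne_top ENNReal.ofReal_ne_top),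
      lintegral_interlace_swap (measurable_comp_diagonal hm)]
    simp only [mul_assoc]

/-! ### Symmetrisation and ensemble averages -/

theorem measurePreserving_comp_perm {N : ℕ} (σ : Equiv.Perm (Fin N)) :
    MeasurePreserving (fun x : Fin N → ℝ => x ∘ σ) := by
  have h := volume_measurePreserving_piCongrLeft (fun _ : Fin N => ℝ) σ.symm
  convert! h using 1
  funext x i
  have := MeasurableEquiv.piCongrLeft_apply_apply (β := fun _ : Fin N => ℝ) σ.symm x (σ i)
  rw [Equiv.symm_apply_apply] at this
  exact this.symm

/-- An injective tuple has exactly one increasing rearrangement, and h vanishes on the others. So h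
is a sum over permutations of copies of its restriction to the increasing chamber, all with the same
integral. -/
theorem lintegral_eq_factorial_mul {N : ℕ} {h : (Fin N → ℝ) → ENNReal} (hm : Measurable h)
    (hs : ∀ (σ : Equiv.Perm (Fin N)) x, h (x ∘ σ) = h x)
    (h0 : ∀ x, ¬ Function.Injective x → h x = 0) :
    ∫⁻ x, h x = (N.factorial : ENNReal) * ∫⁻ x in {x | StrictMono x}, h x := by
  have hS := measurableSet_strictMono N
  have hdec : ∀ x, h x = ∑ σ : Equiv.Perm (Fin N), {x | StrictMono x}.indicator h (x ∘ σ) := by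
    intro x
    by_cases hx : Function.Injective x
    · have hmono : StrictMono (x ∘ Tuple.sort x) :=
        (Tuple.monotone_sort x).strictMono_of_injective (hx.comp (Tuple.sort x).injective)
      rw [Finset.sum_eq_single (Tuple.sort x), Set.indicator_of_mem (by exact hmono), hs]
      · intro σ _ hσ
        refine Set.indicator_of_notMem (fun hσm : StrictMono (x ∘ σ) => hσ ?_) _
        have : x ∘ σ = x ∘ Tuple.sort x := by
          refine (StrictMono.range_inj hσm hmono).1 ?_
          rw [Set.range_comp, Set.range_comp, σ.range_eq_univ, (Tuple.sort x).range_eq_univ]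
        exact Equiv.ext fun i => hx (congrFun this i)
      · simp
    · rw [h0 x hx]
      symm
      refine Finset.sum_eq_zero fun σ _ => Set.indicator_of_notMem (fun hσ : StrictMono (x ∘ σ) => ?_) _
      refine hx fun i j hij => ?_
      have := hσ.injective (a₁ := σ.symm i) (a₂ := σ.symm j) (by simpa using hij)
      exact σ.symm.injective this
  have hmσ : ∀ σ : Equiv.Perm (Fin N), Measurable fun x : Fin N → ℝ =>
      {x | StrictMono x}.indicator h (x ∘ σ) := fun σ =>
    (hm.indicator hS).comp (measurePreserving_comp_perm σ).measurable
  rw [lintegral_congr hdec, lintegral_finsetSum _ fun σ _ => hmσ σ]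
  simp only [(measurePreserving_comp_perm _).lintegral_comp (hm.indicator hS),
    lintegral_indicator hS]
  simp [Fintype.card_perm]

theorem vdet_comp_perm_sq {N : ℕ} (σ : Equiv.Perm (Fin N)) (x : Fin N → ℝ) :
    vdet (x ∘ σ) ^ 2 = vdet x ^ 2 := by
  have : Matrix.vandermonde (x ∘ σ) = (Matrix.vandermonde x).submatrix σ id := rfl
  rw [vdet, this, Matrix.det_permute, mul_pow]
  have h : ((Equiv.Perm.sign σ : ℤ) : ℝ) ^ 2 = 1 := by
    rcases Int.units_eq_one_or (Equiv.Perm.sign σ) with h | h <;> simp [h]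
  rw [h, one_mul, vdet]

theorem vdet_eq_zero {N : ℕ} {x : Fin N → ℝ} (hx : ¬ Function.Injective x) : vdet x = 0 := by
  by_contra h
  exact hx (Matrix.det_vandermonde_ne_zero_iff.1 h)

theorem diagonal_isHermitian {N : ℕ} (x : Fin N → ℝ) :
    (Matrix.diagonal fun i => (x i : ℂ)).IsHermitian := by
  rw [← herm_diagonal]; exact herm_isHermitian _

theorem exists_lintegral_herm_eq' (N : ℕ) : ∃ c : ENNReal, c ≠ 0 ∧ c ≠ ⊤ ∧
    ∀ f : Matrix (Fin N) (Fin N) ℂ → ENNReal, IsClassFun f → (Measurable fun a => f (herm a)) →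
      ∫⁻ a, f (herm a) = c * ∫⁻ x : Fin N → ℝ,
        ENNReal.ofReal (vdet x ^ 2) * f (Matrix.diagonal fun i => (x i : ℂ)) := by
  obtain ⟨c, hc0, hct, hc⟩ := exists_lintegral_herm_eq N
  have hN : (N.factorial : ENNReal) ≠ 0 := by exact_mod_cast N.factorial_ne_zero
  have hN' : (N.factorial : ENNReal) ≠ ⊤ := ENNReal.natCast_ne_top _
  refine ⟨c * (N.factorial : ENNReal)⁻¹, mul_ne_zero hc0 (ENNReal.inv_ne_zero.2 hN'),
    ENNReal.mul_ne_top hct (ENNReal.inv_ne_top.2 hN), fun f hf hm => ?_⟩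
  rw [hc f hf hm, lintegral_eq_factorial_mul (h := fun x => ENNReal.ofReal (vdet x ^ 2) *
    f (Matrix.diagonal fun i => (x i : ℂ))), mul_assoc, ← mul_assoc (N.factorial : ENNReal)⁻¹,
    ENNReal.inv_mul_cancel hN hN', one_mul]
  · exact (continuous_vdet.pow 2).measurable.ennreal_ofReal.mul (measurable_comp_diagonal hm)
  · intro σ x
    rw [vdet_comp_perm_sq]
    congr 1
    refine hf _ _ (diagonal_isHermitian _) (diagonal_isHermitian _) ?_
    rw [Matrix.charpoly_diagonal, Matrix.charpoly_diagonal]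
    exact Equiv.prod_comp σ fun i => (Polynomial.X - Polynomial.C (x i : ℂ))
  · intro x hx
    rw [vdet_eq_zero hx]
    simp

/-- Unnormalised joint density of the eigenvalues for the weight `w`. -/
def eigDensity {N : ℕ} (w : ℝ → ℝ) (x : Fin N → ℝ) : ℝ := vdet x ^ 2 * ∏ i, w (x i)

theorem eigDensity_nonneg {N : ℕ} {w : ℝ → ℝ} (hw : ∀ x, 0 ≤ w x) (x : Fin N → ℝ) :
    0 ≤ eigDensity w x :=
  mul_nonneg (sq_nonneg _) (Finset.prod_nonneg fun _ _ => hw _)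

theorem measurable_eigDensity {N : ℕ} {w : ℝ → ℝ} (hw : Measurable w) :
    Measurable (eigDensity w : (Fin N → ℝ) → ℝ) := by
  have := (continuous_vdet (n := N)).measurable
  unfold eigDensity
  fun_prop

/-- Averages of class functions over a unitary ensemble in terms of the eigenvalues. -/
theorem ensemble_average {N : ℕ} {w : ℝ → ℝ} (hw0 : ∀ x, 0 ≤ w x) (hwm : Measurable w)
    {f : Matrix (Fin N) (Fin N) ℂ → ℝ} (hf : IsClassFun f) (hfm : Measurable fun a => f (herm a))
    (hfw : ∀ x : Fin N → ℝ, f (Matrix.diagonal fun i => (x i : ℂ)) = ∏ i, w (x i))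
    (hW : Integrable (eigDensity w : (Fin N → ℝ) → ℝ)) (hZ : 0 < ∫ x : Fin N → ℝ, eigDensity w x)
    {g : Matrix (Fin N) (Fin N) ℂ → ℂ} (hg : IsClassFun g) (hgm : Measurable fun a => g (herm a))
    (hgW : Integrable fun x : Fin N → ℝ => eigDensity w x • g (Matrix.diagonal fun i => (x i : ℂ))) :
    IsProbabilityMeasure (ensemble N f) ∧ Integrable (fun a => g (herm a)) (ensemble N f) ∧
    ∫ a, g (herm a) ∂ensemble N f = (∫ x : Fin N → ℝ, eigDensity w x)⁻¹ •
      ∫ x : Fin N → ℝ, eigDensity w x • g (Matrix.diagonal fun i => (x i : ℂ)) := by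
  obtain ⟨c, hc0, hct, hc⟩ := exists_lintegral_herm_eq' N
  set m₁ : Measure (Fin N → Fin N → ℝ) :=
    volume.withDensity fun a => ENNReal.ofReal (f (herm a)) with hm₁
  set m₂ : Measure (Fin N → ℝ) := volume.withDensity fun x => ENNReal.ofReal (eigDensity w x)
    with hm₂
  have hgd : Measurable fun x : Fin N → ℝ => g (Matrix.diagonal fun i => (x i : ℂ)) := by
    simp only [← herm_diagonal]
    refine hgm.comp (measurable_pi_lambda _ fun i => measurable_pi_lambda _ fun j => ?_)
    simp only [Matrix.diagonal_apply]
    split_ifs <;> fun_prop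
  -- The Weyl formula, tested on indicators of {g ∈ S}, compares the unnormalised laws of g. Total
  -- mass, integrability and the integral of the complex function g all follow from this equality,
  -- and c cancels.
  have hmap : Measure.map (fun a => g (herm a)) m₁ =
      c • Measure.map (fun x : Fin N → ℝ => g (Matrix.diagonal fun i => (x i : ℂ))) m₂ := by
    ext S hS
    rw [Measure.smul_apply, Measure.map_apply hgm hS, Measure.map_apply hgd hS,
      withDensity_apply _ (hgm hS), withDensity_apply _ (hgd hS), ← lintegral_indicator (hgm hS),
      ← lintegral_indicator (hgd hS), smul_eq_mul]
    have h := hc (fun A => (S.indicator 1 (g A) : ENNReal) * ENNReal.ofReal (f A))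
      (fun A B hA hB hAB => by simp only [hf A B hA hB hAB, hg A B hA hB hAB])
      (((measurable_one.indicator hS).comp hgm).mul hfm.ennreal_ofReal)
    have e1 : ∀ a, ((fun a => g (herm a)) ⁻¹' S).indicator
        (fun a => ENNReal.ofReal (f (herm a))) a =
        (S.indicator 1 (g (herm a)) : ENNReal) * ENNReal.ofReal (f (herm a)) := fun a => by
      by_cases ha : g (herm a) ∈ S
      · rw [Set.indicator_of_mem (by exact ha), Set.indicator_of_mem ha]; simp
      · rw [Set.indicator_of_notMem (by exact ha), Set.indicator_of_notMem ha]; simp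
    simp only [e1]
    rw [h]
    congr 1
    refine lintegral_congr fun x => ?_
    rw [hfw]
    by_cases ha : g (Matrix.diagonal fun i => (x i : ℂ)) ∈ S
    · rw [Set.indicator_of_mem ha, Set.indicator_of_mem (by exact ha), Pi.one_apply, one_mul,
        ← ENNReal.ofReal_mul (sq_nonneg _), eigDensity]
    · rw [Set.indicator_of_notMem ha, Set.indicator_of_notMem (by exact ha), zero_mul, mul_zero]
  set Z := ∫ x : Fin N → ℝ, eigDensity w x with hZdef
  have hm₂u : m₂ Set.univ = ENNReal.ofReal Z := by
    rw [hm₂, withDensity_apply _ MeasurableSet.univ, Measure.restrict_univ,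
      ofReal_integral_eq_lintegral_ofReal hW (Filter.Eventually.of_forall (eigDensity_nonneg hw0))]
  have hm₁u : m₁ Set.univ = c * ENNReal.ofReal Z := by
    have h := congrArg (fun μ => μ Set.univ) hmap
    simp only [Measure.smul_apply, Measure.map_apply hgm MeasurableSet.univ,
      Measure.map_apply hgd MeasurableSet.univ, Set.preimage_univ, hm₂u, smul_eq_mul] at h
    exact h
  have hZ0 : ENNReal.ofReal Z ≠ 0 := by simpa using hZ
  have hu0 : m₁ Set.univ ≠ 0 := by rw [hm₁u]; exact mul_ne_zero hc0 hZ0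
  have hut : m₁ Set.univ ≠ ⊤ := by rw [hm₁u]; exact ENNReal.mul_ne_top hct ENNReal.ofReal_ne_top
  have hens : ensemble N f = (m₁ Set.univ)⁻¹ • m₁ := rfl
  have hdm : Measurable fun x : Fin N → ℝ => ENNReal.ofReal (eigDensity w x) :=
    (measurable_eigDensity hwm).ennreal_ofReal
  have hdt : ∀ᵐ x : Fin N → ℝ, ENNReal.ofReal (eigDensity w x) < ⊤ :=
    Filter.Eventually.of_forall fun x => ENNReal.ofReal_lt_top
  have htoReal : ∀ x : Fin N → ℝ, (ENNReal.ofReal (eigDensity w x)).toReal = eigDensity w x :=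
    fun x => ENNReal.toReal_ofReal (eigDensity_nonneg hw0 x)
  have hint₂ : Integrable (fun x : Fin N → ℝ => g (Matrix.diagonal fun i => (x i : ℂ))) m₂ := by
    rw [hm₂, integrable_withDensity_iff_integrable_smul' hdm hdt]
    simpa only [htoReal] using hgW
  have hint₁ : Integrable (fun a => g (herm a)) m₁ := by
    have h : Integrable id (Measure.map (fun a => g (herm a)) m₁) := by
      rw [hmap]
      exact Integrable.smul_measure ((integrable_map_measure aestronglyMeasurable_id
        hgd.aemeasurable).2 hint₂) hct
    exact (integrable_map_measure aestronglyMeasurable_id hgm.aemeasurable).1 h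
  have hval₁ : ∫ a, g (herm a) ∂m₁ =
      c.toReal • ∫ x : Fin N → ℝ, eigDensity w x • g (Matrix.diagonal fun i => (x i : ℂ)) := by
    have h1 := integral_map (μ := m₁) hgm.aemeasurable (f := id) aestronglyMeasurable_id
    have h2 := integral_map (μ := m₂) hgd.aemeasurable (f := id) aestronglyMeasurable_id
    simp only [id] at h1 h2
    rw [← h1, hmap, integral_smul_measure, h2, hm₂,
      integral_withDensity_eq_integral_toReal_smul hdm hdt]
    simp only [htoReal]
  refine ⟨⟨?_⟩, ?_, ?_⟩
  · rw [hens, Measure.smul_apply, smul_eq_mul, ENNReal.inv_mul_cancel hu0 hut]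
  · rw [hens]
    exact hint₁.smul_measure (ENNReal.inv_ne_top.2 hu0)
  · rw [hens, integral_smul_measure, hval₁, hm₁u, smul_smul, ENNReal.toReal_inv,
      ENNReal.toReal_mul, ENNReal.toReal_ofReal hZ.le]
    congr 1
    have : c.toReal ≠ 0 := ENNReal.toReal_ne_zero.2 ⟨hc0, hct⟩
    field_simp

/-! ### Averages of characteristic polynomials over the eigenvalues -/

/-- The difference product `∏_{i<j} (yᵢ - yⱼ)`. -/
def diffProd {R : Type*} [CommRing R] {n : ℕ} (y : Fin n → R) : R :=
  ∏ i, ∏ j, if i < j then y i - y j else 1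

theorem diffProd_eq_prod_Ioi {R : Type*} [CommRing R] {n : ℕ} (y : Fin n → R) :
    diffProd y = ∏ i, ∏ j ∈ Finset.Ioi i, (y i - y j) := by
  refine Finset.prod_congr rfl fun i _ => ?_
  rw [← Finset.prod_filter]
  exact Finset.prod_congr (by ext; simp) fun _ _ => rfl

/-- The mixed pairs, with t before x, contribute exactly the characteristic polynomials. -/
theorem diffProd_append {R : Type*} [CommRing R] {p N : ℕ} (t : Fin p → R) (x : Fin N → R) :
    diffProd (Fin.append t x) = diffProd t * (∏ j, ∏ i, (t j - x i)) * diffProd x := by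
  have h : ∀ (i : Fin p) (j : Fin N), Fin.castAdd N i < Fin.natAdd p j := fun i j => by
    rw [Fin.lt_def]; simp; omega
  have h' : ∀ i j : Fin p, Fin.castAdd N i < Fin.castAdd N j ↔ i < j := fun _ _ => Iff.rfl
  simp [diffProd, Fin.prod_univ_add, Finset.prod_mul_distrib, h, h', (h _ _).not_gt, mul_assoc]

/-- Column operations replace powers by monic polynomials. Listing the degrees in decreasing order
gives the sign convention y_i - y_j for i < j. -/
theorem diffProd_eq_det {R : Type*} [CommRing R] {n : ℕ} (y : Fin n → R) {q : ℕ → Polynomial R}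
    (hq : ∀ k, (q k).Monic) (hd : ∀ k, (q k).natDegree = k) :
    diffProd y = (Matrix.of fun k m : Fin n => (q (Fin.rev m : ℕ)).eval (y k)).det := by
  have h1 := Matrix.det_eval_matrixOfPolynomials_eq_det_vandermonde y (fun i => q i)
    (fun i => hd i) (fun i => hq i)
  have h2 : (Matrix.of fun k m : Fin n => (q (Fin.rev m : ℕ)).eval (y k)) =
      (Matrix.of fun k m : Fin n => (q m).eval (y k)).submatrix id Fin.revPerm := rfl
  have h3 : Matrix.projVandermonde 1 y = (Matrix.vandermonde y).submatrix id Fin.revPerm := by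
    ext i j
    simp [Matrix.projVandermonde_apply, Matrix.vandermonde_apply]
  have h4 := Matrix.det_projVandermonde 1 y
  rw [h3, Matrix.det_permute'] at h4
  rw [h2, Matrix.det_permute', ← h1, h4, diffProd_eq_prod_Ioi]
  simp

theorem diffProd_sq {n : ℕ} (x : Fin n → ℝ) : diffProd x ^ 2 = vdet x ^ 2 := by
  rw [diffProd_eq_prod_Ioi, vdet, Matrix.det_vandermonde]
  simp only [← Finset.prod_pow]
  exact Finset.prod_congr rfl fun i _ => Finset.prod_congr rfl fun j _ => by ring

/-- As in `integral_det_pi`, but the rows indexed by κ are constants: they will carry the fixed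
points t_j. -/
theorem integral_det_sumElim {κ ι α : Type*} [Fintype κ] [DecidableEq κ] [Fintype ι] [DecidableEq ι]
    [MeasurableSpace α] {μ : Measure α} [SigmaFinite μ] (T : κ → κ ⊕ ι → ℂ)
    {F : ι → κ ⊕ ι → α → ℂ} (hF : ∀ i m, Integrable (F i m) μ) :
    Integrable (fun x : ι → α =>
      (Matrix.of (Sum.elim T fun i m => F i m (x i))).det) (Measure.pi fun _ => μ) ∧
    ∫ x : ι → α, (Matrix.of (Sum.elim T fun i m => F i m (x i))).det ∂(Measure.pi fun _ => μ) =
      (Matrix.of (Sum.elim T fun i m => ∫ y, F i m y ∂μ)).det := by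
  have h : ∀ M : Matrix (κ ⊕ ι) (κ ⊕ ι) ℂ, M.det = ∑ σ : Equiv.Perm (κ ⊕ ι),
      (((Equiv.Perm.sign σ : ℤ) : ℂ) * ∏ j, M (.inl j) (σ (.inl j))) *
        ∏ i, M (.inr i) (σ (.inr i)) := fun M => by
    rw [← Matrix.det_transpose, Matrix.det_apply']
    refine Finset.sum_congr rfl fun σ _ => ?_
    rw [Fintype.prod_sum_type, mul_assoc]
    rfl
  simp only [h, Matrix.of_apply, Sum.elim_inl, Sum.elim_inr]
  have hi : ∀ σ ∈ (Finset.univ : Finset (Equiv.Perm (κ ⊕ ι))), Integrable (fun x : ι → α =>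
      (((Equiv.Perm.sign σ : ℤ) : ℂ) * ∏ j, T j (σ (.inl j))) * ∏ i, F i (σ (.inr i)) (x i))
      (Measure.pi fun _ => μ) := fun σ _ =>
    (Integrable.fintype_prod fun i => hF i (σ (.inr i))).const_mul _
  refine ⟨integrable_finsetSum _ hi, ?_⟩
  rw [integral_finsetSum _ hi]
  refine Finset.sum_congr rfl fun σ _ => ?_
  rw [integral_const_mul, integral_fintype_prod_eq_prod fun i => F i (σ (.inr i))]

theorem det_permuted_diagonal {n R : Type*} [Fintype n] [DecidableEq n] [CommRing R] (d : n → R)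
    (σ : Equiv.Perm n) : (Matrix.of fun i j => if j = σ i then d (σ i) else 0).det =
      Equiv.Perm.sign σ * ∏ i, d i := by
  rw [← Matrix.det_diagonal, ← Matrix.det_permute]
  congr 1
  ext i j
  simp [Matrix.diagonal_apply, eq_comm]

/-! ### Integrating the enlarged determinant against a weight -/

section weight

variable {w : ℝ → ℝ}

theorem integrable_eval_mul (hw : ∀ k : ℕ, Integrable fun x => x ^ k * w x) (q : Polynomial ℝ) :
    Integrable fun x => q.eval x * w x := by
  simp only [Polynomial.eval_eq_sum_range, Finset.sum_mul, mul_assoc]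
  exact integrable_finsetSum _ fun k _ => (hw k).const_mul _

theorem integrable_eval_mul_prod {N : ℕ} (hw : ∀ k : ℕ, Integrable fun x => x ^ k * w x)
    (P : MvPolynomial (Fin N) ℂ) : Integrable fun x : Fin N → ℝ =>
      MvPolynomial.eval (fun i => (x i : ℂ)) P * ((∏ i, w (x i) : ℝ) : ℂ) := by
  simp only [MvPolynomial.eval_eq', Finset.sum_mul, mul_assoc]
  refine integrable_finsetSum _ fun d _ => Integrable.const_mul ?_ _
  have h : Integrable fun x : Fin N → ℝ => ((∏ i, (x i ^ d i * w (x i)) : ℝ) : ℂ) :=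
    (Integrable.fintype_prod (μ := fun _ => volume) fun i => hw (d i)).ofReal
  refine h.congr (Filter.Eventually.of_forall fun x => ?_)
  simp [Finset.prod_mul_distrib]

theorem integrable_eigDensity_smul {N : ℕ} (hw : ∀ k : ℕ, Integrable fun x => x ^ k * w x)
    (P : MvPolynomial (Fin N) ℂ) : Integrable fun x : Fin N → ℝ =>
      eigDensity w x • MvPolynomial.eval (fun i => (x i : ℂ)) P := by
  let V : MvPolynomial (Fin N) ℂ :=
    ∏ i, ∏ j ∈ Finset.Ioi i, (MvPolynomial.X j - MvPolynomial.X i)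
  refine (integrable_eval_mul_prod hw (V ^ 2 * P)).congr (Filter.Eventually.of_forall fun x => ?_)
  simp only [V, eigDensity, vdet, Matrix.det_vandermonde, map_mul, map_pow, map_prod, map_sub,
    MvPolynomial.eval_X, Complex.real_smul, Complex.ofReal_mul, Complex.ofReal_pow,
    Complex.ofReal_prod, Complex.ofReal_sub]
  ring

variable {q : ℕ → Polynomial ℝ}

/-- The columns of the enlarged determinant. -/
def colDeg (p N : ℕ) : Fin p ⊕ Fin N → ℕ := Sum.elim (fun i => N + (Fin.rev i : ℕ)) fun l => Fin.rev l

/-- Vandermonde product of the joined tuple. The columns split into degrees at least N and degrees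
below N, which is where orthogonality will separate the blocks. -/
theorem diffProd_mul_prod_eq_det {p N : ℕ} (hq : ∀ k, (q k).Monic) (hd : ∀ k, (q k).natDegree = k)
    (t : Fin p → ℂ) (x : Fin N → ℝ) :
    diffProd t * (∏ j, ∏ i, (t j - x i)) * ((diffProd x : ℝ) : ℂ) =
      (Matrix.of (Sum.elim (fun j m => Polynomial.aeval (t j) (q (colDeg p N m)))
        fun i m => ((((q (colDeg p N m)).eval (x i) : ℝ)) : ℂ))).det := by
  have hx : ((diffProd x : ℝ) : ℂ) = diffProd fun i => (x i : ℂ) := by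
    simp only [diffProd, Complex.ofReal_prod]
    refine Finset.prod_congr rfl fun i _ => Finset.prod_congr rfl fun j _ => ?_
    split_ifs <;> simp
  rw [hx, ← diffProd_append, diffProd_eq_det _
    (q := fun k => (q k).map (algebraMap ℝ ℂ)) (fun k => (hq k).map _)
    (fun k => by rw [(hq k).natDegree_map, hd]), ← Matrix.det_submatrix_equiv_self finSumFinEquiv]
  congr 1
  ext k m
  have hcol : ((Fin.rev (finSumFinEquiv m) : Fin (p + N)) : ℕ) = colDeg p N m := by
    rcases m with m | m
    · have := m.isLt
      simp [colDeg, Fin.val_rev]; omega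
    · have := m.isLt
      simp [colDeg, Fin.val_rev]; omega
  rw [Matrix.submatrix_apply, Matrix.of_apply, hcol]
  rcases k with k | k
  · simp [Polynomial.eval_map_algebraMap]
  · simp only [finSumFinEquiv_apply_right, Fin.append_right, Matrix.of_apply, Sum.elim_inr]
    exact Polynomial.eval_map_algebraMap _ _ |>.trans (Polynomial.aeval_algebraMap_apply ℂ (x k) _)

/-- One factor Δ(x) completes the enlarged determinant; the other is expanded over σ, and its
factors are moved, with the weights, into the rows of x. Integration kills these rows in all columns
of degree at least N. The remaining N × N block is diagonal up to σ, its sign cancels that of the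
expansion, and all N! terms agree. -/
theorem diffProd_mul_integral {p N : ℕ} (hw : ∀ k : ℕ, Integrable fun x => x ^ k * w x)
    (hq : ∀ k, (q k).Monic) (hd : ∀ k, (q k).natDegree = k)
    (horth : ∀ k l, k ≠ l → ∫ x, (q k).eval x * (q l).eval x * w x = 0) (t : Fin p → ℂ) :
    diffProd t * ∫ x : Fin N → ℝ, eigDensity w x • ∏ j, ∏ i, (t j - (x i : ℂ)) =
      ((N.factorial * ∏ l : Fin N, ∫ x, (q l).eval x * (q l).eval x * w x : ℝ) : ℂ) *
        (Matrix.of fun i j : Fin p => Polynomial.aeval (t j) (q (N + (Fin.rev i : ℕ)))).det := by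
  let H : Fin N → ℝ := fun l =>
    ∫ x, (q (Fin.rev l : ℕ)).eval x * (q (Fin.rev l : ℕ)).eval x * w x
  have hH : ∏ l : Fin N, ∫ x, (q l).eval x * (q l).eval x * w x = ∏ l, H l :=
    (Equiv.prod_comp Fin.revPerm fun l : Fin N => ∫ x, (q l).eval x * (q l).eval x * w x).symm
  let T : Fin p → Fin p ⊕ Fin N → ℂ := fun j m => Polynomial.aeval (t j) (q (colDeg p N m))
  let F : Equiv.Perm (Fin N) → Fin N → Fin p ⊕ Fin N → ℝ → ℂ := fun σ i m y =>
    (((q (Fin.rev (σ i) : ℕ)).eval y * (q (colDeg p N m)).eval y * w y : ℝ) : ℂ)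
  have hF : ∀ σ i m, Integrable (F σ i m) := fun σ i m => by
    have := integrable_eval_mul hw (q (Fin.rev (σ i) : ℕ) * q (colDeg p N m))
    simp only [Polynomial.eval_mul] at this
    exact this.ofReal
  have hpt : ∀ x : Fin N → ℝ, diffProd t * (eigDensity w x • ∏ j, ∏ i, (t j - (x i : ℂ))) =
      ∑ σ : Equiv.Perm (Fin N), ((Equiv.Perm.sign σ : ℤ) : ℂ) *
        (Matrix.of (Sum.elim T fun i m => F σ i m (x i))).det := by
    intro x
    have h1 := diffProd_mul_prod_eq_det hq hd t x
    have h2 : diffProd x = ∑ σ : Equiv.Perm (Fin N), ((Equiv.Perm.sign σ : ℤ) : ℝ) *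
        ∏ i, (q (Fin.rev (σ i) : ℕ)).eval (x i) := by
      rw [diffProd_eq_det x hq hd, ← Matrix.det_transpose, Matrix.det_apply']
      rfl
    have h3 : ∀ σ : Equiv.Perm (Fin N), (Matrix.of (Sum.elim T fun i m => F σ i m (x i))).det =
        (((∏ i, (q (Fin.rev (σ i) : ℕ)).eval (x i) * w (x i) : ℝ)) : ℂ) *
          (diffProd t * (∏ j, ∏ i, (t j - x i)) * ((diffProd x : ℝ) : ℂ)) := fun σ => by
      rw [h1]
      have := Matrix.det_mul_column
        (Sum.elim (fun _ => 1) fun i => (((q (Fin.rev (σ i) : ℕ)).eval (x i) * w (x i) : ℝ) : ℂ))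
        (Matrix.of (Sum.elim T fun i m => ((((q (colDeg p N m)).eval (x i) : ℝ)) : ℂ)))
      rw [Fintype.prod_sum_type] at this
      simp only [Sum.elim_inl, Sum.elim_inr, Finset.prod_const_one, one_mul] at this
      rw [Complex.ofReal_prod]
      rw [← this]
      congr 1
      ext k m
      rcases k with k | k
      · simp
      · simp only [Matrix.of_apply, Sum.elim_inr, F]
        push_cast
        ring
    simp only [h3, Finset.prod_mul_distrib]
    have h4 : (eigDensity w x : ℂ) = ((diffProd x : ℝ) : ℂ) * ((diffProd x : ℝ) : ℂ) *
        ((∏ i, w (x i) : ℝ) : ℂ) := by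
      rw [eigDensity, ← diffProd_sq, sq]; push_cast; ring
    have h5 : ((diffProd x : ℝ) : ℂ) = ∑ σ : Equiv.Perm (Fin N), ((Equiv.Perm.sign σ : ℤ) : ℂ) *
        ((∏ i, (q (Fin.rev (σ i) : ℕ)).eval (x i) : ℝ) : ℂ) := by
      rw [h2]; push_cast; rfl
    rw [Complex.real_smul, h4]
    nth_rw 1 [h5]
    simp only [Finset.sum_mul, Finset.mul_sum]
    refine Finset.sum_congr rfl fun σ _ => ?_
    push_cast
    ring
  rw [← integral_const_mul]
  simp only [hpt]
  have hdet := fun σ => integral_det_sumElim (μ := (volume : Measure ℝ)) T (hF σ)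
  simp only [volume_pi]
  rw [integral_finsetSum _ fun σ _ => (hdet σ).1.const_mul _]
  -- Block triangularity: row i of the x-part tests against a polynomial of degree below N, so only
  -- the column of that same degree survives.
  have hval : ∀ σ : Equiv.Perm (Fin N), (Matrix.of (Sum.elim T fun i m => ∫ y, F σ i m y)).det =
      (Matrix.of fun i j : Fin p => Polynomial.aeval (t j) (q (N + (Fin.rev i : ℕ)))).det *
        (((Equiv.Perm.sign σ : ℤ) : ℂ) * ∏ l, (H l : ℂ)) := fun σ => by
    rw [← det_permuted_diagonal, ← Matrix.det_transpose (Matrix.of fun i j : Fin p => _),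
      ← Matrix.det_fromBlocks_zero₂₁ _ (Matrix.of fun j l => T j (.inr l))]
    congr 1
    ext k m
    rcases k with k | k <;> rcases m with m | m
    · rfl
    · rfl
    · simp only [Matrix.of_apply, Sum.elim_inr, F, Matrix.fromBlocks_apply₂₁, Matrix.zero_apply]
      rw [integral_complex_ofReal, horth _ _ ?_, Complex.ofReal_zero]
      have := (Fin.rev (σ k)).isLt
      simp only [colDeg, Sum.elim_inl]
      omega
    · simp only [Matrix.of_apply, Sum.elim_inr, F, Matrix.fromBlocks_apply₂₂]
      rw [integral_complex_ofReal]
      split_ifs with h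
      · rw [h]; rfl
      · rw [horth _ _ ?_, Complex.ofReal_zero]
        simp only [colDeg, Sum.elim_inr]
        intro h'
        exact h (Fin.rev_injective (Fin.ext h')).symm
  simp only [integral_const_mul, (hdet _).2, hval]
  have hsign : ∀ σ : Equiv.Perm (Fin N), ((Equiv.Perm.sign σ : ℤ) : ℂ) *
      ((Equiv.Perm.sign σ : ℤ) : ℂ) = 1 := fun σ => by
    rcases Int.units_eq_one_or (Equiv.Perm.sign σ) with h | h <;> simp [h]
  rw [Finset.sum_congr rfl fun σ _ => show _ = (Matrix.of fun i j : Fin p =>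
    Polynomial.aeval (t j) (q (N + (Fin.rev i : ℕ)))).det * ∏ l, (H l : ℂ) by
      rw [mul_left_comm, ← mul_assoc (((Equiv.Perm.sign σ : ℤ) : ℂ)), hsign, one_mul]]
  rw [Finset.sum_const, Finset.card_univ, Fintype.card_perm, Fintype.card_fin, hH, nsmul_eq_mul]
  push_cast
  ring

end weight

/-! ### Characteristic polynomials of unitary ensembles -/

theorem charProd_eq_charpoly {N p : ℕ} (t : Fin p → ℂ) (M : Matrix (Fin N) (Fin N) ℂ) :
    charProd t M = ∏ j, M.charpoly.eval (t j) := by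
  simp only [charProd, Matrix.eval_charpoly, Matrix.scalar_apply, Matrix.smul_one_eq_diagonal]

theorem isClassFun_charProd {N p : ℕ} (t : Fin p → ℂ) :
    IsClassFun (charProd t : Matrix (Fin N) (Fin N) ℂ → ℂ) := fun A B _ _ h => by
  rw [charProd_eq_charpoly, charProd_eq_charpoly, h]

theorem charProd_diagonal {N p : ℕ} (t : Fin p → ℂ) (x : Fin N → ℝ) :
    charProd t (Matrix.diagonal fun i => (x i : ℂ)) = ∏ j, ∏ i, (t j - (x i : ℂ)) := by
  simp [charProd_eq_charpoly, Matrix.charpoly_diagonal, Polynomial.eval_prod]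

theorem continuous_charProd {N p : ℕ} (t : Fin p → ℂ) :
    Continuous fun a : Fin N → Fin N → ℝ => charProd t (herm a) := by
  unfold charProd
  exact continuous_finsetProd _ fun j _ => (continuous_const.sub continuous_herm).matrix_det

theorem isClassFun_of_conj {N : ℕ} {α : Type*} {f : Matrix (Fin N) (Fin N) ℂ → α}
    (h : ∀ U A : Matrix (Fin N) (Fin N) ℂ, star U * U = 1 → f (U * A * star U) = f A) :
    IsClassFun f := fun A B hA hB hAB => by
  obtain ⟨U, hU, rfl⟩ := exists_conj_of_charpoly_eq hA hB hAB
  exact (h U A hU).symm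

theorem aeval_vandermonde {p : ℕ} (t : Fin p → ℂ) :
    MvPolynomial.aeval t (vandermonde p) = diffProd t := by
  simp only [vandermonde, diffProd, Finset.prod_filter, map_prod]
  rw [Fintype.prod_prod_type]
  refine Finset.prod_congr rfl fun i _ => Finset.prod_congr rfl fun j _ => ?_
  split_ifs <;> simp

theorem aeval_alternant {p : ℕ} (φ : ℕ → Polynomial ℝ) (lam : Fin p → ℕ) (t : Fin p → ℂ) :
    MvPolynomial.aeval t (alternant φ lam) =
      (Matrix.of fun i j : Fin p => Polynomial.aeval (t j) (φ (lam i + (Fin.rev i : ℕ)))).det := by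
  rw [alternant, AlgHom.map_det]
  congr 1
  ext i j
  simp [← Polynomial.aeval_algHom_apply]

theorem multi_eq_of_alternant_eq {p : ℕ} {φ ψ : ℕ → Polynomial ℝ} {lam : Fin p → ℕ} {c : ℝ}
    (h : alternant φ lam = MvPolynomial.C c * alternant ψ lam) :
    multi φ lam = MvPolynomial.C c * multi ψ lam := by
  refine mul_left_cancel₀ (vandermonde_ne_zero p) ?_
  rw [vandermonde_mul_multi, h, mul_left_comm, vandermonde_mul_multi]

/-- For the rectangular partition the row indices run through N, …, N+p-1 once each, so the row
scalings multiply up to the prefactor. -/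
theorem multi_rect_C_mul {p N : ℕ} (φ : ℕ → Polynomial ℝ) (c : ℕ → ℝ) :
    multi (fun n => Polynomial.C (c n) * φ n) (rect N p) =
      MvPolynomial.C (∏ j ∈ Finset.Ico N (p + N), c j) * multi φ (rect N p) := by
  refine multi_eq_of_alternant_eq ?_
  have hc : ∏ j ∈ Finset.Ico N (p + N), c j = ∏ i : Fin p, c (N + (Fin.rev i : ℕ)) := by
    rw [Finset.prod_Ico_eq_prod_range, Nat.add_sub_cancel, Finset.prod_range]
    exact (Equiv.prod_comp Fin.revPerm fun i : Fin p => c (N + i)).symm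
  have h := Matrix.det_mul_column
    (fun i : Fin p => (MvPolynomial.C (c (N + (Fin.rev i : ℕ))) : MvPolynomial (Fin p) ℝ))
    (Matrix.of fun i j : Fin p => Polynomial.aeval (MvPolynomial.X j : MvPolynomial (Fin p) ℝ)
      (φ (rect N p i + (Fin.rev i : ℕ))))
  rw [alternant, alternant, hc, map_prod, ← h]
  congr 1
  ext1 i j
  simp only [Matrix.of_apply, rect, map_mul, Polynomial.aeval_C, MvPolynomial.algebraMap_eq]

/-! ### From orthogonal polynomials to ensemble averages -/

section weight

variable {w : ℝ → ℝ} {q : ℕ → Polynomial ℝ}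

theorem integrable_eigDensity_smul_prod {N p : ℕ} (hw : ∀ k : ℕ, Integrable fun x => x ^ k * w x)
    (t : Fin p → ℂ) : Integrable fun x : Fin N → ℝ =>
      eigDensity w x • ∏ j, ∏ i, (t j - (x i : ℂ)) := by
  have := integrable_eigDensity_smul hw
    (∏ j, ∏ i, (MvPolynomial.C (t j) - MvPolynomial.X i) : MvPolynomial (Fin N) ℂ)
  simpa only [map_prod, map_sub, MvPolynomial.eval_C, MvPolynomial.eval_X] using this

/-- The average of a product of characteristic polynomials is a polynomial. -/
theorem exists_mvPolynomial_eq_integral {N p : ℕ} (hw : ∀ k : ℕ, Integrable fun x => x ^ k * w x) :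
    ∃ Q : MvPolynomial (Fin p) ℂ, ∀ t : Fin p → ℂ, MvPolynomial.eval t Q =
      ∫ x : Fin N → ℝ, eigDensity w x • ∏ j, ∏ i, (t j - (x i : ℂ)) := by
  -- Expansion of ∏(t_j - x_i) over sets s of pairs: t_j is taken from the pairs in s, -x_i from the
  -- others.
  let S : Finset (Finset (Fin p × Fin N)) := Finset.univ.powerset
  let R : Finset (Fin p × Fin N) → (Fin N → ℝ) → ℂ := fun s x =>
    eigDensity w x • ∏ e ∈ Finset.univ \ s, -(x e.2 : ℂ)
  have hR : ∀ s, Integrable (R s) := fun s => by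
    have := integrable_eigDensity_smul hw
      (∏ e ∈ Finset.univ \ s, -MvPolynomial.X e.2 : MvPolynomial (Fin N) ℂ)
    simpa only [map_prod, map_neg, MvPolynomial.eval_X] using this
  refine ⟨∑ s ∈ S, (∏ e ∈ s, MvPolynomial.X e.1) * MvPolynomial.C (∫ x, R s x), fun t => ?_⟩
  have hpt : ∀ x : Fin N → ℝ, eigDensity w x • ∏ j, ∏ i, (t j - (x i : ℂ)) =
      ∑ s ∈ S, (∏ e ∈ s, t e.1) * R s x := fun x => by
    rw [← Fintype.prod_prod_type' fun j i => t j - (x i : ℂ)]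
    simp only [sub_eq_add_neg]
    rw [Finset.prod_add, Finset.smul_sum]
    exact Finset.sum_congr rfl fun s _ => (mul_smul_comm _ _ _).symm
  simp only [hpt]
  rw [integral_finsetSum _ fun s _ => (hR s).const_mul _]
  simp [integral_const_mul]

/-- `diffProd_mul_integral` says nothing at coinciding t_j. Both sides being polynomials in t, the
nonzero Vandermonde polynomial is cancelled instead of its values. -/
theorem integral_eq_mul_multi {N p : ℕ} (hw : ∀ k : ℕ, Integrable fun x => x ^ k * w x)
    (hq : ∀ k, (q k).Monic) (hd : ∀ k, (q k).natDegree = k)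
    (horth : ∀ k l, k ≠ l → ∫ x, (q k).eval x * (q l).eval x * w x = 0) (t : Fin p → ℂ) :
    ∫ x : Fin N → ℝ, eigDensity w x • ∏ j, ∏ i, (t j - (x i : ℂ)) =
      ((N.factorial * ∏ l : Fin N, ∫ x, (q l).eval x * (q l).eval x * w x : ℝ) : ℂ) *
        MvPolynomial.aeval t (multi q (rect N p)) := by
  obtain ⟨Q, hQ⟩ := exists_mvPolynomial_eq_integral (N := N) (p := p) hw
  set K : ℝ := N.factorial * ∏ l : Fin N, ∫ x, (q l).eval x * (q l).eval x * w x
  let ι := algebraMap ℝ ℂ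
  have hev : ∀ (P : MvPolynomial (Fin p) ℝ) (t : Fin p → ℂ),
      MvPolynomial.eval t (MvPolynomial.map ι P) = MvPolynomial.aeval t P := fun P t => by
    rw [MvPolynomial.eval_map, MvPolynomial.aeval_def]
  have hmul : MvPolynomial.map ι (vandermonde p) * Q = MvPolynomial.map ι (vandermonde p) *
      (MvPolynomial.C (K : ℂ) * MvPolynomial.map ι (multi q (rect N p))) := by
    refine MvPolynomial.funext fun s => ?_
    rw [map_mul, map_mul, map_mul, hev, hev, hQ, aeval_vandermonde, MvPolynomial.eval_C,
      diffProd_mul_integral hw hq hd horth s, mul_left_comm, ← aeval_vandermonde, ← map_mul,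
      vandermonde_mul_multi, aeval_alternant]
    rfl
  have h0 : MvPolynomial.map ι (vandermonde p) ≠ 0 := fun h =>
    vandermonde_ne_zero p (MvPolynomial.map_injective ι (algebraMap ℝ ℂ).injective
      (h.trans (map_zero _).symm))
  rw [← hQ, mul_left_cancel₀ h0 hmul, map_mul, MvPolynomial.eval_C, hev]

/-- The roots of r form a null set, so the integrand is positive on almost all of the support of w.
-/
theorem integral_sq_mul_pos (hw : ∀ k : ℕ, Integrable fun x => x ^ k * w x) (hw0 : ∀ x, 0 ≤ w x)
    (hws : volume (Function.support w) ≠ 0) {r : Polynomial ℝ} (hr : r ≠ 0) :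
    0 < ∫ x, r.eval x * r.eval x * w x := by
  have hi := integrable_eval_mul hw (r * r)
  simp only [Polynomial.eval_mul] at hi
  rw [integral_pos_iff_support_of_nonneg (fun x => mul_nonneg (mul_self_nonneg _) (hw0 x)) hi]
  have hs : Function.support (fun x => r.eval x * r.eval x * w x) =
      Function.support w \ {x | r.IsRoot x} := by
    ext x
    simp only [Function.mem_support, ne_eq, mul_eq_zero, or_self, not_or, Set.mem_sdiff,
      Set.mem_ofPred_eq, Polynomial.IsRoot.def]
    exact and_comm
  rw [hs, measure_sdiff_null ((Polynomial.finite_setOfPred_isRoot hr).measure_zero _)]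
  exact pos_iff_ne_zero.2 hws

/-- Averages of products of characteristic polynomials over the unitary ensemble with weight `w`,
in terms of (not necessarily monic) orthogonal polynomials. -/
theorem ensemble_average_charProd {N p : ℕ} (hwm : Measurable w)
    (hw : ∀ k : ℕ, Integrable fun x => x ^ k * w x) (hw0 : ∀ x, 0 ≤ w x)
    (hws : volume (Function.support w) ≠ 0)
    {φ : ℕ → Polynomial ℝ} (hd : ∀ k, (φ k).natDegree ≤ k) (hdeg : ∀ k, (φ k).coeff k ≠ 0)
    (horth : ∀ k (r : Polynomial ℝ), r.natDegree < k → ∫ x, (φ k).eval x * r.eval x * w x = 0)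
    {f : Matrix (Fin N) (Fin N) ℂ → ℝ} (hf : IsClassFun f) (hfm : Measurable fun a => f (herm a))
    (hfw : ∀ x : Fin N → ℝ, f (Matrix.diagonal fun i => (x i : ℂ)) = ∏ i, w (x i))
    (t : Fin p → ℂ) :
    IsProbabilityMeasure (ensemble N f) ∧
    Integrable (fun a => charProd t (herm a)) (ensemble N f) ∧
    ∫ a, charProd t (herm a) ∂ensemble N f =
      ((∏ j ∈ Finset.Ico N (p + N), ((φ j).coeff j)⁻¹ : ℝ) : ℂ) *
        MvPolynomial.aeval t (multi φ (rect N p)) := by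
  obtain ⟨c, hcdef⟩ : ∃ c : ℕ → ℝ, c = fun k => ((φ k).coeff k)⁻¹ := ⟨_, rfl⟩
  obtain ⟨q, hqdef⟩ : ∃ q : ℕ → Polynomial ℝ, q = fun k => Polynomial.C (c k) * φ k := ⟨_, rfl⟩
  have hφd : ∀ k, (φ k).natDegree = k := fun k =>
    le_antisymm (hd k) (Polynomial.le_natDegree_of_ne_zero (hdeg k))
  have hc : ∀ k, c k ≠ 0 := fun k => by rw [hcdef]; exact inv_ne_zero (hdeg k)
  have hqm : ∀ k, (q k).Monic := fun k => by
    rw [hqdef, hcdef]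
    refine Polynomial.monic_C_mul_of_mul_leadingCoeff_eq_one ?_
    rw [Polynomial.leadingCoeff, hφd]
    exact inv_mul_cancel₀ (hdeg k)
  have hqd : ∀ k, (q k).natDegree = k := fun k => by
    rw [hqdef, Polynomial.natDegree_C_mul (hc k), hφd]
  have horthq : ∀ k l, k ≠ l → ∫ x, (q k).eval x * (q l).eval x * w x = 0 := by
    have key : ∀ k l, l < k → ∫ x, (q k).eval x * (q l).eval x * w x = 0 := fun k l hkl => by
      have h := horth k (q l) (by rw [hqd]; exact hkl)
      have : ∀ x, (q k).eval x * (q l).eval x * w x = c k * ((φ k).eval x * (q l).eval x * w x) :=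
        fun x => by simp only [hqdef, Polynomial.eval_mul, Polynomial.eval_C]; ring
      simp only [this]
      rw [integral_const_mul, h, mul_zero]
    intro k l hkl
    rcases lt_or_gt_of_ne hkl with h | h
    · rw [← key l k h]
      exact integral_congr_ae (Filter.Eventually.of_forall fun x => by ring)
    · exact key k l h
  obtain ⟨K, hK⟩ : ∃ K : ℝ, K =
    N.factorial * ∏ l : Fin N, ∫ x, (q l).eval x * (q l).eval x * w x := ⟨_, rfl⟩
  have hKpos : 0 < K := hK ▸ mul_pos (by exact_mod_cast N.factorial_pos)
    (Finset.prod_pos fun l _ => integral_sq_mul_pos hw hw0 hws (hqm l).ne_zero)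
  have hI := fun (n : ℕ) (s : Fin n → ℂ) => integral_eq_mul_multi (N := N) hw hqm hqd horthq s
  rw [← hK] at hI
  have hW : Integrable (eigDensity w : (Fin N → ℝ) → ℝ) := by
    have := (integrable_eigDensity_smul_prod (N := N) (p := 0) hw Fin.elim0).re
    simpa using this
  -- The normalising constant is the case p = 0 of the same identity.
  have hZ : ∫ x : Fin N → ℝ, eigDensity w x = K := by
    have h := hI 0 Fin.elim0
    have h1 : multi q (rect N 0) = 1 := by
      have := vandermonde_mul_multi q (rect N 0)
      simpa [vandermonde, alternant] using this
    simp only [Finset.univ_eq_empty, Finset.prod_empty, h1, map_one, mul_one, Complex.real_smul]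
      at h
    rw [integral_complex_ofReal] at h
    exact_mod_cast h
  obtain ⟨h1, h2, h3⟩ := ensemble_average hw0 hwm hf hfm hfw hW (by rw [hZ]; exact hKpos)
    (isClassFun_charProd t) (continuous_charProd t).measurable
    (by simpa only [charProd_diagonal] using integrable_eigDensity_smul_prod hw t)
  refine ⟨h1, h2, h3.trans ?_⟩
  simp only [charProd_diagonal]
  rw [hZ, hI p t, hqdef, multi_rect_C_mul, map_mul, MvPolynomial.aeval_C, Complex.real_smul,
    ← mul_assoc, ← Complex.ofReal_mul, inv_mul_cancel₀ hKpos.ne', Complex.ofReal_one, one_mul, hcdef]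
  rfl

end weight

section polynomial

open Polynomial

/-! ### Orthogonality from moments -/

/-- Up to the factor (-1)^n / n! this is the n-th forward difference of P at 0. -/
theorem sum_alternating_eval_eq_zero {P : ℝ[X]} {n : ℕ} (hP : P.natDegree < n) :
    ∑ j ∈ Finset.range (n + 1), (-1 : ℝ) ^ j / (j.factorial * (n - j).factorial) * P.eval (j : ℝ) =
      0 := by
  have h := congrFun (Polynomial.fwdDiff_iter_eq_zero_of_degree_lt hP) 0
  rw [fwdDiff_iter_eq_sum_shift, Pi.zero_apply] at h
  have h2 := congrArg (fun y => (-1 : ℝ) ^ n / n.factorial * y) h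
  simp only [mul_zero, Finset.mul_sum] at h2
  rw [← h2]
  refine Finset.sum_congr rfl fun j hj => ?_
  have hjn : j ≤ n := Nat.lt_succ_iff.1 (Finset.mem_range.1 hj)
  have hsign : (-1 : ℝ) ^ n * (-1) ^ (n - j) = (-1) ^ j := by
    have : (-1 : ℝ) ^ n = (-1) ^ (n - j) * (-1) ^ j := by rw [← pow_add, Nat.sub_add_cancel hjn]
    rw [this, mul_right_comm, ← mul_pow]
    simp
  rw [zsmul_eq_mul, zero_add, nsmul_eq_mul, mul_one]
  push_cast
  rw [Nat.cast_choose ℝ hjn, ← hsign]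
  have := Nat.factorial_ne_zero n
  field_simp

theorem integral_mul_eq_zero_of_moments {w : ℝ → ℝ} (hw : ∀ k : ℕ, Integrable fun x => x ^ k * w x)
    {μ : ℕ → ℝ} (hμ : ∀ k : ℕ, ∫ x, x ^ k * w x = μ k) {q : ℝ[X]} {n : ℕ} (hq : q.natDegree ≤ n)
    (h : ∀ m < n, ∑ j ∈ Finset.range (n + 1), q.coeff j * μ (j + m) = 0) (r : ℝ[X])
    (hr : r.natDegree < n) : ∫ x, q.eval x * r.eval x * w x = 0 := by
  have hpt : ∀ x, q.eval x * r.eval x * w x = ∑ m ∈ Finset.range (r.natDegree + 1),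
      ∑ j ∈ Finset.range (n + 1), r.coeff m * (q.coeff j * (x ^ (j + m) * w x)) := fun x => by
    rw [eval_eq_sum_range' (Nat.lt_succ_of_le hq), eval_eq_sum_range (p := r), Finset.sum_mul_sum,
      Finset.sum_comm, Finset.sum_mul]
    refine Finset.sum_congr rfl fun m _ => ?_
    rw [Finset.sum_mul]
    exact Finset.sum_congr rfl fun j _ => by ring
  have hi : ∀ m j, Integrable fun x => r.coeff m * (q.coeff j * (x ^ (j + m) * w x)) := fun m j =>
    ((hw (j + m)).const_mul _).const_mul _
  simp only [hpt]
  rw [integral_finsetSum _ fun m _ => integrable_finsetSum _ fun j _ => hi m j]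
  refine Finset.sum_eq_zero fun m hm => ?_
  rw [integral_finsetSum _ fun j _ => hi m j]
  simp only [integral_const_mul, hμ]
  rw [← Finset.mul_sum, h m (by have := Finset.mem_range.1 hm; omega), mul_zero]

theorem coeff_sum_monomial (c : ℕ → ℝ) (n k : ℕ) (hk : k ≤ n) :
    (∑ j ∈ Finset.range (n + 1), monomial j (c j)).coeff k = c k := by
  simp [coeff_monomial]
  omega

theorem natDegree_sum_monomial_le (c : ℕ → ℝ) (n : ℕ) :
    (∑ j ∈ Finset.range (n + 1), monomial j (c j)).natDegree ≤ n :=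
  natDegree_sum_le_of_forall_le _ _ fun _ hj =>
    (natDegree_monomial_le _).trans (Nat.lt_succ_iff.1 (Finset.mem_range.1 hj))

/-! ### Invariance and measurability of the densities -/

theorem posDef_conj_iff {N : ℕ} {U : Matrix (Fin N) (Fin N) ℂ} (hU : star U * U = 1)
    (A : Matrix (Fin N) (Fin N) ℂ) : (U * A * star U).PosDef ↔ A.PosDef :=
  Matrix.IsUnit.posDef_star_right_conjugate_iff (IsUnit.of_mul_eq_one_right _ hU)

theorem det_conj {N : ℕ} {U : Matrix (Fin N) (Fin N) ℂ} (hU : star U * U = 1)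
    (A : Matrix (Fin N) (Fin N) ℂ) : (U * A * star U).det = A.det := by
  rw [Matrix.det_mul_right_comm, Matrix.det_mul, mul_eq_one_comm.1 hU, Matrix.det_one, one_mul]

theorem trace_conj {N : ℕ} {U : Matrix (Fin N) (Fin N) ℂ} (hU : star U * U = 1)
    (A : Matrix (Fin N) (Fin N) ℂ) : (U * A * star U).trace = A.trace := by
  rw [Matrix.trace_mul_cycle, hU, one_mul]

theorem one_sub_conj {N : ℕ} {U : Matrix (Fin N) (Fin N) ℂ} (hU : star U * U = 1)
    (A : Matrix (Fin N) (Fin N) ℂ) : 1 - U * A * star U = U * (1 - A) * star U := by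
  rw [mul_sub, sub_mul, mul_one, mul_eq_one_comm.1 hU]

/-- Positive definite means positive semidefinite, a closed condition, with nonzero determinant, an
open one. -/
theorem measurableSet_posDef {X : Type*} [TopologicalSpace X] [MeasurableSpace X] [BorelSpace X]
    {N : ℕ} {A : X → Matrix (Fin N) (Fin N) ℂ} (hA : Continuous A) (hH : ∀ a, (A a).IsHermitian) :
    MeasurableSet {a | (A a).PosDef} := by
  have h : {a | (A a).PosDef} = {a | (A a).PosSemidef} ∩ {a | (A a).det ≠ 0} := by
    ext a
    refine ⟨fun h => ⟨h.posSemidef, h.det_pos.ne'⟩, fun h => h.1.posDef_iff_det_ne_zero.2 h.2⟩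
  have h1 : {a | (A a).PosSemidef} =
      ⋂ x : Fin N → ℂ, {a | 0 ≤ dotProduct (star x) (Matrix.mulVec (A a) x)} := by
    ext a
    simp only [Set.mem_iInter, Set.mem_ofPred_eq, Matrix.posSemidef_iff_dotProduct_mulVec]
    exact ⟨fun h => h.2, fun h => ⟨hH a, h⟩⟩
  rw [h]
  refine MeasurableSet.inter ?_ ?_
  · rw [h1]
    refine (isClosed_iInter fun x => ?_).measurableSet
    exact isClosed_le continuous_const
      (continuous_const.dotProduct (hA.matrix_mulVec continuous_const))
  · exact (isOpen_ne_fun hA.matrix_det continuous_const).measurableSet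

theorem posDef_diagonal_iff' {N : ℕ} (x : Fin N → ℝ) :
    (Matrix.diagonal fun i => (x i : ℂ)).PosDef ↔ ∀ i, 0 < x i := by
  rw [Matrix.posDef_diagonal_iff]
  simp

theorem one_sub_diagonal {N : ℕ} (x : Fin N → ℝ) :
    1 - (Matrix.diagonal fun i => (x i : ℂ)) = Matrix.diagonal fun i => ((1 - x i : ℝ) : ℂ) := by
  rw [← Matrix.diagonal_one, Matrix.diagonal_sub]
  simp

theorem det_diagonal_re {N : ℕ} (x : Fin N → ℝ) :
    (Matrix.diagonal fun i => (x i : ℂ)).det.re = ∏ i, x i := by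
  rw [Matrix.det_diagonal, ← Complex.ofReal_prod, Complex.ofReal_re]

theorem trace_diagonal_re {N : ℕ} (x : Fin N → ℝ) :
    (Matrix.diagonal fun i => (x i : ℂ)).trace.re = ∑ i, x i := by
  rw [Matrix.trace_diagonal, ← Complex.ofReal_sum, Complex.ofReal_re]

/-! ### The Gaussian unitary ensemble -/

theorem integrable_pow_mul_exp_neg_sq (k : ℕ) :
    Integrable fun x : ℝ => x ^ k * Real.exp (-x ^ 2 / 2) := by
  have h := integrable_rpow_mul_exp_neg_mul_sq (b := 1 / 2) (by norm_num)
    (s := k) (by have : (0 : ℝ) ≤ k := Nat.cast_nonneg k; linarith)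
  refine h.congr (Filter.Eventually.of_forall fun x => ?_)
  simp only [Real.rpow_natCast]
  congr 2
  ring

theorem hermiteP_succ (n : ℕ) : hermiteP (n + 1) = X * hermiteP n - derivative (hermiteP n) := by
  simp [hermiteP, hermite_succ, derivative_map]

/-- Integration by parts: by the recursion, H_{n+1} times the weight is minus the derivative of H_n
times the weight. -/
theorem integral_hermiteP_succ_mul (n : ℕ) (r : ℝ[X]) :
    ∫ x, (hermiteP (n + 1)).eval x * r.eval x * Real.exp (-x ^ 2 / 2) =
      ∫ x, (hermiteP n).eval x * (derivative r).eval x * Real.exp (-x ^ 2 / 2) := by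
  have hint : ∀ s : ℝ[X], Integrable fun x => s.eval x * Real.exp (-x ^ 2 / 2) := fun s =>
    integrable_eval_mul integrable_pow_mul_exp_neg_sq s
  let G : ℝ[X] := hermiteP n * derivative r - hermiteP (n + 1) * r
  have hder : ∀ x, HasDerivAt (fun x => (hermiteP n * r).eval x * Real.exp (-x ^ 2 / 2))
      (G.eval x * Real.exp (-x ^ 2 / 2)) x := fun x => by
    have h1 := (hermiteP n * r).hasDerivAt x
    have h2 : HasDerivAt (fun x : ℝ => Real.exp (-x ^ 2 / 2)) (Real.exp (-x ^ 2 / 2) * (-x)) x := by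
      have : HasDerivAt (fun x : ℝ => -x ^ 2 / 2) (-x) x := by
        convert! ((hasDerivAt_pow 2 x).neg).div_const 2 using 1
        simp
        ring
      exact this.exp
    refine (h1.mul h2).congr_deriv ?_
    simp only [G, hermiteP_succ, eval_sub, eval_mul, eval_X, derivative_mul, eval_add]
    ring
  have h := integral_eq_zero_of_hasDerivAt_of_integrable hder (hint G) (hint _)
  have hsub : ∀ x, G.eval x * Real.exp (-x ^ 2 / 2) =
      (hermiteP n * derivative r).eval x * Real.exp (-x ^ 2 / 2) -
        (hermiteP (n + 1) * r).eval x * Real.exp (-x ^ 2 / 2) := fun x => by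
    simp only [G, eval_sub, sub_mul]
  simp only [hsub] at h
  rw [integral_sub (hint _) (hint _), sub_eq_zero] at h
  simp only [eval_mul] at h
  exact h.symm

theorem integral_hermiteP_mul_eq_zero (n : ℕ) (r : ℝ[X]) (hr : r.natDegree < n) :
    ∫ x, (hermiteP n).eval x * r.eval x * Real.exp (-x ^ 2 / 2) = 0 := by
  induction n generalizing r with
  | zero => exact absurd hr (Nat.not_lt_zero _)
  | succ n ih =>
    rw [integral_hermiteP_succ_mul]
    -- A constant r has derivative 0, while its `natDegree` cannot drop further; hence the separate
    -- case.
    rcases Nat.eq_zero_or_pos r.natDegree with h | h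
    · rw [eq_C_of_natDegree_eq_zero h]
      simp
    · exact ih _ ((natDegree_derivative_lt h.ne').trans_le (Nat.lt_succ_iff.1 hr))

theorem GUE_average {N p : ℕ} (t : Fin p → ℂ) :
    IsProbabilityMeasure (GUE N) ∧ Integrable (fun a => charProd t (herm a)) (GUE N) ∧
    ∫ a, charProd t (herm a) ∂GUE N = MvPolynomial.aeval t (multiHermite (rect N p)) := by
  have hself : ∀ k, (hermiteP k).coeff k = 1 := fun k => by
    rw [hermiteP, coeff_map, coeff_hermite_self, map_one]
  have h := ensemble_average_charProd (N := N) (w := fun x => Real.exp (-x ^ 2 / 2))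
    (φ := hermiteP) (f := fun M => Real.exp (-(M * M).trace.re / 2)) (by fun_prop)
    integrable_pow_mul_exp_neg_sq (fun x => (Real.exp_pos _).le) ?_
    (fun k => natDegree_map_le.trans natDegree_hermite.le)
    (fun k => by rw [hself]; exact one_ne_zero) integral_hermiteP_mul_eq_zero ?_ ?_ ?_ t
  · simpa [hself, GUE, multiHermite] using h
  · have : Function.support (fun x : ℝ => Real.exp (-x ^ 2 / 2)) = Set.univ :=
      Set.eq_univ_of_forall fun x => (Real.exp_pos _).ne'
    rw [this]; simp
  · refine isClassFun_of_conj fun U A hU => ?_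
    have : U * A * star U * (U * A * star U) = U * (A * A) * star U := by
      calc _ = U * A * (star U * U) * A * star U := by simp only [mul_assoc]
        _ = _ := by rw [hU, mul_one, mul_assoc U A A]
    simp only [this, trace_conj hU]
  · have h1 := continuous_herm (N := N)
    have h2 : Continuous fun a : Fin N → Fin N → ℝ => (herm a * herm a).trace :=
      (h1.matrix_mul h1).matrix_trace
    have h3 := Complex.continuous_re.comp h2
    exact (Real.continuous_exp.comp (h3.neg.div_const 2)).measurable
  · intro x
    have : (Matrix.diagonal fun i => (x i : ℂ)) * (Matrix.diagonal fun i => (x i : ℂ)) =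
        Matrix.diagonal fun i => ((x i ^ 2 : ℝ) : ℂ) := by
      rw [Matrix.diagonal_mul_diagonal]
      simp [sq]
    rw [this, trace_diagonal_re, ← Real.exp_sum, ← Finset.sum_neg_distrib, Finset.sum_div]

end polynomial

section polynomial

open Polynomial

/-! ### The Laguerre unitary ensemble -/

/-- The Laguerre weight. -/
def laguerreWeight (γ x : ℝ) : ℝ := if 0 < x then x ^ γ * Real.exp (-x) else 0

theorem pow_mul_laguerreWeight (γ : ℝ) (k : ℕ) :
    (fun x => x ^ k * laguerreWeight γ x) =
      (Set.Ioi 0).indicator fun x => Real.exp (-x) * x ^ ((k + γ + 1) - 1) := by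
  funext x
  by_cases hx : 0 < x
  · rw [Set.indicator_of_mem (by exact hx), laguerreWeight, if_pos hx, add_sub_cancel_right,
      Real.rpow_add hx, Real.rpow_natCast]
    ring
  · rw [Set.indicator_of_notMem (by exact hx), laguerreWeight, if_neg hx, mul_zero]

theorem integrable_pow_mul_laguerreWeight {γ : ℝ} (hγ : -1 < γ) (k : ℕ) :
    Integrable fun x => x ^ k * laguerreWeight γ x := by
  have hk : (0 : ℝ) ≤ k := Nat.cast_nonneg k
  rw [pow_mul_laguerreWeight, integrable_indicator_iff measurableSet_Ioi]
  exact Real.GammaIntegral_convergent (by linarith)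

theorem integral_pow_mul_laguerreWeight {γ : ℝ} (hγ : -1 < γ) (k : ℕ) :
    ∫ x, x ^ k * laguerreWeight γ x = Real.Gamma (k + γ + 1) := by
  have hk : (0 : ℝ) ≤ k := Nat.cast_nonneg k
  rw [pow_mul_laguerreWeight, integral_indicator measurableSet_Ioi,
    Real.Gamma_eq_integral (by linarith)]

theorem gamma_add_nat_eq {x : ℝ} (hx : 0 < x) (m : ℕ) :
    Real.Gamma (x + m) = (ascPochhammer ℝ m).eval x * Real.Gamma x := by
  rw [gamma_quotient x (fun k => by have : (0 : ℝ) ≤ k := Nat.cast_nonneg k; linarith) m,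
    div_mul_cancel₀ _ (Real.Gamma_pos_of_pos hx).ne']

/-- The rising factorial of `X + b` of length `m`. -/
def shiftedPochhammer (m : ℕ) (b : ℝ) : ℝ[X] := (ascPochhammer ℝ m).comp (X + C b)

theorem eval_shiftedPochhammer (m : ℕ) (b x : ℝ) :
    (shiftedPochhammer m b).eval x = (ascPochhammer ℝ m).eval (x + b) := by
  simp [shiftedPochhammer]

theorem natDegree_shiftedPochhammer (m : ℕ) (b : ℝ) : (shiftedPochhammer m b).natDegree = m := by
  rw [shiftedPochhammer, natDegree_comp, natDegree_X_add_C, mul_one, ascPochhammer_natDegree]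

theorem laguerreP_coeff (γ : ℝ) {n j : ℕ} (hj : j ≤ n) : (laguerreP γ n).coeff j =
    (-1) ^ j * Real.Gamma (n + γ + 1) /
      (Real.Gamma (j + γ + 1) * (n - j).factorial * j.factorial) :=
  coeff_sum_monomial _ n j hj

/-- The moment divided by Γ(j+γ+1) is the rising factorial of j+γ+1 of length m, a polynomial in j
of degree m < n. -/
theorem sum_laguerreP_coeff_mul {γ : ℝ} (hγ : -1 < γ) {m n : ℕ} (hm : m < n) :
    ∑ j ∈ Finset.range (n + 1), (laguerreP γ n).coeff j * Real.Gamma ((j + m : ℕ) + γ + 1) = 0 := by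
  have h := sum_alternating_eval_eq_zero (P := shiftedPochhammer m (γ + 1)) (n := n)
    (by rwa [natDegree_shiftedPochhammer])
  have h2 := congrArg (fun y => Real.Gamma (n + γ + 1) * y) h
  simp only [mul_zero, Finset.mul_sum] at h2
  rw [← h2]
  refine Finset.sum_congr rfl fun j hj => ?_
  have hk : (0 : ℝ) ≤ j := Nat.cast_nonneg j
  have hpos : 0 < (j : ℝ) + γ + 1 := by linarith
  have hG := (Real.Gamma_pos_of_pos hpos).ne'
  have e : ((j + m : ℕ) : ℝ) + γ + 1 = (j + γ + 1) + m := by push_cast; ring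
  rw [laguerreP_coeff γ (Nat.lt_succ_iff.1 (Finset.mem_range.1 hj)), e, gamma_add_nat_eq hpos,
    eval_shiftedPochhammer, ← add_assoc]
  field_simp

theorem measurable_laguerreWeight (γ : ℝ) : Measurable (laguerreWeight γ) :=
  Measurable.ite measurableSet_Ioi (by fun_prop) measurable_const

theorem laguerreWeight_nonneg (γ x : ℝ) : 0 ≤ laguerreWeight γ x := by
  unfold laguerreWeight
  split_ifs <;> positivity

theorem prod_ite_forall {ι : Type*} [Fintype ι] (P : ι → Prop) [DecidablePred P]
    [Decidable (∀ i, P i)] (f : ι → ℝ) :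
    ∏ i, (if P i then f i else 0) = if ∀ i, P i then ∏ i, f i else 0 := by
  split_ifs with h
  · exact Finset.prod_congr rfl fun i _ => if_pos (h i)
  · obtain ⟨i, hi⟩ := not_forall.1 h
    exact Finset.prod_eq_zero (Finset.mem_univ i) (if_neg hi)

theorem LUE_average {N p : ℕ} {γ : ℝ} (hγ : -1 < γ) (t : Fin p → ℂ) :
    IsProbabilityMeasure (LUE N γ) ∧ Integrable (fun a => charProd t (herm a)) (LUE N γ) ∧
    ∫ a, charProd t (herm a) ∂LUE N γ =
      ((∏ j ∈ Finset.Ico N (p + N), (-1 : ℝ) ^ j * (j.factorial : ℝ) : ℝ) : ℂ) *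
        MvPolynomial.aeval t (multiLaguerre γ (rect N p)) := by
  classical
  have hΓ : ∀ n : ℕ, Real.Gamma (n + γ + 1) ≠ 0 := fun n => by
    have : (0 : ℝ) ≤ n := Nat.cast_nonneg n
    exact (Real.Gamma_pos_of_pos (by linarith)).ne'
  have hlead : ∀ n, (laguerreP γ n).coeff n = (-1) ^ n / n.factorial := fun n => by
    rw [laguerreP_coeff γ le_rfl, Nat.sub_self, Nat.factorial_zero, Nat.cast_one, mul_one,
      mul_comm (Real.Gamma _), mul_div_mul_right _ _ (hΓ n)]
  have hinv : ∀ n, ((laguerreP γ n).coeff n)⁻¹ = (-1) ^ n * n.factorial := fun n => by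
    rw [hlead, inv_div, div_eq_mul_inv, mul_comm, ← inv_pow]
    norm_num
  have hw := integrable_pow_mul_laguerreWeight hγ
  have h := ensemble_average_charProd (N := N) (p := p) (w := laguerreWeight γ) (φ := laguerreP γ)
    (f := fun M => if M.PosDef then M.det.re ^ γ * Real.exp (-M.trace.re) else 0)
    (measurable_laguerreWeight γ) hw (laguerreWeight_nonneg γ) ?_
    (fun n => natDegree_sum_monomial_le _ n) (fun n => ?_)
    (fun n => integral_mul_eq_zero_of_moments hw (integral_pow_mul_laguerreWeight hγ)
      (natDegree_sum_monomial_le _ n) fun m hm => sum_laguerreP_coeff_mul hγ hm) ?_ ?_ ?_ t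
  · simp only [hinv] at h
    exact h
  · have hsub : Set.Ioi 0 ⊆ Function.support (laguerreWeight γ) := fun x (hx : 0 < x) => by
      rw [Function.mem_support, laguerreWeight, if_pos hx]
      positivity
    refine (lt_of_lt_of_le ?_ (measure_mono hsub)).ne'
    simp
  · rw [hlead]
    have := Nat.factorial_ne_zero n
    exact div_ne_zero (pow_ne_zero _ (by norm_num)) (by exact_mod_cast this)
  · refine isClassFun_of_conj fun U A hU => ?_
    simp only [posDef_conj_iff hU, det_conj hU, trace_conj hU]
  · have h1 := continuous_herm (N := N)
    have h2 := (Complex.continuous_re.comp h1.matrix_det).measurable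
    have h3 := (Complex.continuous_re.comp h1.matrix_trace).measurable
    exact Measurable.ite (measurableSet_posDef h1 herm_isHermitian)
      ((h2.pow_const γ).mul h3.neg.exp) measurable_const
  · intro x
    simp only [posDef_diagonal_iff', det_diagonal_re, trace_diagonal_re, laguerreWeight]
    rw [prod_ite_forall]
    split_ifs with hx
    · rw [Finset.prod_mul_distrib, Real.finsetProd_rpow _ _ fun i _ => (hx i).le, ← Real.exp_sum,
        Finset.sum_neg_distrib]
    · rfl

/-! ### The Jacobi unitary ensemble -/

/-- The Jacobi weight. -/
def jacobiWeight (γ₁ γ₂ x : ℝ) : ℝ := if 0 < x ∧ x < 1 then x ^ γ₁ * (1 - x) ^ γ₂ else 0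

/-- As a multiple of a Beta density, this is integrable and its integral is a Beta value. -/
theorem pow_mul_jacobiWeight {γ₁ γ₂ : ℝ} (h₁ : -1 < γ₁) (h₂ : -1 < γ₂) (k : ℕ) :
    (fun x => x ^ k * jacobiWeight γ₁ γ₂ x) = fun x => ProbabilityTheory.beta (k + γ₁ + 1) (γ₂ + 1) *
      ProbabilityTheory.betaPDFReal (k + γ₁ + 1) (γ₂ + 1) x := by
  have hk : (0 : ℝ) ≤ k := Nat.cast_nonneg k
  have hb := (ProbabilityTheory.beta_pos (α := k + γ₁ + 1) (β := γ₂ + 1) (by linarith)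
    (by linarith)).ne'
  funext x
  rw [jacobiWeight, ProbabilityTheory.betaPDFReal]
  split_ifs with hx
  · rw [add_sub_cancel_right, add_sub_cancel_right, Real.rpow_add hx.1, Real.rpow_natCast]
    field_simp
  · simp

theorem integrable_betaPDFReal {a b : ℝ} (ha : 0 < a) (hb : 0 < b) :
    Integrable (ProbabilityTheory.betaPDFReal a b) ∧
      ∫ x, ProbabilityTheory.betaPDFReal a b x = 1 := by
  have hnn : ∀ x, 0 ≤ ProbabilityTheory.betaPDFReal a b x := fun x => by
    by_cases hx : 0 < x ∧ x < 1
    · exact (ProbabilityTheory.betaPDFReal_pos hx.1 hx.2 ha hb).le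
    · rw [ProbabilityTheory.betaPDFReal, if_neg hx]
  have hm := ProbabilityTheory.measurable_betaPDFReal a b
  have h1 : ∫⁻ x, ENNReal.ofReal (ProbabilityTheory.betaPDFReal a b x) = 1 :=
    ProbabilityTheory.lintegral_betaPDF_eq_one ha hb
  refine ⟨⟨hm.aestronglyMeasurable, ?_⟩, ?_⟩
  · rw [hasFiniteIntegral_iff_ofReal (Filter.Eventually.of_forall hnn), h1]
    exact ENNReal.one_lt_top
  · rw [integral_eq_lintegral_of_nonneg_ae (Filter.Eventually.of_forall hnn)
      hm.aestronglyMeasurable, h1, ENNReal.toReal_one]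

theorem integrable_pow_mul_jacobiWeight {γ₁ γ₂ : ℝ} (h₁ : -1 < γ₁) (h₂ : -1 < γ₂) (k : ℕ) :
    Integrable fun x => x ^ k * jacobiWeight γ₁ γ₂ x := by
  have hk : (0 : ℝ) ≤ k := Nat.cast_nonneg k
  rw [pow_mul_jacobiWeight h₁ h₂]
  exact (integrable_betaPDFReal (by linarith) (by linarith)).1.const_mul _

theorem integral_pow_mul_jacobiWeight {γ₁ γ₂ : ℝ} (h₁ : -1 < γ₁) (h₂ : -1 < γ₂) (k : ℕ) :
    ∫ x, x ^ k * jacobiWeight γ₁ γ₂ x = ProbabilityTheory.beta (k + γ₁ + 1) (γ₂ + 1) := by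
  have hk : (0 : ℝ) ≤ k := Nat.cast_nonneg k
  rw [pow_mul_jacobiWeight h₁ h₂, integral_const_mul,
    (integrable_betaPDFReal (by linarith) (by linarith)).2, mul_one]

theorem jacobiP_coeff (γ₁ γ₂ : ℝ) {n j : ℕ} (hj : j ≤ n) : (jacobiP γ₁ γ₂ n).coeff j =
    (-1) ^ j / (j.factorial * (n - j).factorial) *
      (Real.Gamma (n + γ₁ + 1) / Real.Gamma (j + γ₁ + 1)) *
      (ascPochhammer ℝ j).eval (n + γ₁ + γ₂ + 1) :=
  coeff_sum_monomial _ n j hj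

/-- Two Gamma quotients depend on j: Γ(j+m+γ₁+1)/Γ(j+γ₁+1), of degree m in j, and
Γ(n+j+γ₁+γ₂+1)/Γ(j+m+γ₁+γ₂+2), of degree n-1-m. Their product has degree n-1 < n. -/
theorem sum_jacobiP_coeff_mul {γ₁ γ₂ : ℝ} (h₁ : -1 < γ₁) (h₂ : -1 < γ₂) {m n : ℕ} (hm : m < n) :
    ∑ j ∈ Finset.range (n + 1), (jacobiP γ₁ γ₂ n).coeff j *
      ProbabilityTheory.beta ((j + m : ℕ) + γ₁ + 1) (γ₂ + 1) = 0 := by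
  have h := sum_alternating_eval_eq_zero (n := n)
    (P := shiftedPochhammer m (γ₁ + 1) * shiftedPochhammer (n - 1 - m) (m + γ₁ + γ₂ + 2))
    (by refine natDegree_mul_le.trans_lt ?_
        rw [natDegree_shiftedPochhammer, natDegree_shiftedPochhammer]
        omega)
  have h2 := congrArg (fun y => Real.Gamma (n + γ₁ + 1) * Real.Gamma (γ₂ + 1) /
    Real.Gamma (n + γ₁ + γ₂ + 1) * y) h
  simp only [mul_zero, Finset.mul_sum] at h2
  rw [← h2]
  refine Finset.sum_congr rfl fun j hj => ?_
  have hk : (0 : ℝ) ≤ j := Nat.cast_nonneg j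
  have hm0 : (0 : ℝ) ≤ m := Nat.cast_nonneg m
  -- With n ≥ 1 the argument n+γ₁+γ₂+1 is positive, which fails in general for n = 0.
  have hn1 : (1 : ℝ) ≤ n := by exact_mod_cast (Nat.zero_le m).trans_lt hm
  have p1 : 0 < (j : ℝ) + γ₁ + 1 := by linarith
  have p2 : 0 < (n : ℝ) + γ₁ + γ₂ + 1 := by linarith
  have p3 : 0 < (j : ℝ) + (m + γ₁ + γ₂ + 2) := by linarith
  have g1 := (Real.Gamma_pos_of_pos p1).ne'
  have g2 := (Real.Gamma_pos_of_pos p2).ne'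
  have g3 := (Real.Gamma_pos_of_pos p3).ne'
  have e1 : ((j + m : ℕ) : ℝ) + γ₁ + 1 = (j + γ₁ + 1) + m := by push_cast; ring
  have e2 : (j : ℝ) + γ₁ + 1 + m + (γ₂ + 1) = j + (m + γ₁ + γ₂ + 2) := by ring
  have e3 : ((n : ℝ) + γ₁ + γ₂ + 1) + j = j + (m + γ₁ + γ₂ + 2) + (n - 1 - m : ℕ) := by
    rw [Nat.sub_sub, Nat.cast_sub (by omega)]
    push_cast
    ring
  have q2 : (ascPochhammer ℝ j).eval ((n : ℝ) + γ₁ + γ₂ + 1) * Real.Gamma (n + γ₁ + γ₂ + 1) =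
      (ascPochhammer ℝ (n - 1 - m)).eval ((j : ℝ) + (m + γ₁ + γ₂ + 2)) *
        Real.Gamma (j + (m + γ₁ + γ₂ + 2)) := by
    rw [← gamma_add_nat_eq p2, e3, gamma_add_nat_eq p3]
  have q2' : (ascPochhammer ℝ j).eval ((n : ℝ) + γ₁ + γ₂ + 1) =
      (ascPochhammer ℝ (n - 1 - m)).eval ((j : ℝ) + (m + γ₁ + γ₂ + 2)) *
        Real.Gamma (j + (m + γ₁ + γ₂ + 2)) / Real.Gamma (n + γ₁ + γ₂ + 1) := by
    rw [← q2, mul_div_cancel_right₀ _ g2]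
  rw [jacobiP_coeff γ₁ γ₂ (Nat.lt_succ_iff.1 (Finset.mem_range.1 hj)), ProbabilityTheory.beta, e1,
    e2, gamma_add_nat_eq p1, q2', eval_mul, eval_shiftedPochhammer, eval_shiftedPochhammer,
    ← add_assoc (j : ℝ) γ₁]
  field_simp

theorem measurable_jacobiWeight (γ₁ γ₂ : ℝ) : Measurable (jacobiWeight γ₁ γ₂) :=
  Measurable.ite measurableSet_Ioo (by fun_prop) measurable_const

theorem jacobiWeight_pos {γ₁ γ₂ x : ℝ} (hx : 0 < x ∧ x < 1) : 0 < jacobiWeight γ₁ γ₂ x := by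
  rw [jacobiWeight, if_pos hx]
  exact mul_pos (Real.rpow_pos_of_pos hx.1 _) (Real.rpow_pos_of_pos (sub_pos.2 hx.2) _)

theorem jacobiWeight_nonneg (γ₁ γ₂ x : ℝ) : 0 ≤ jacobiWeight γ₁ γ₂ x := by
  by_cases hx : 0 < x ∧ x < 1
  · exact (jacobiWeight_pos hx).le
  · rw [jacobiWeight, if_neg hx]

theorem JUE_average {N p : ℕ} (hN : 1 ≤ N) {γ₁ γ₂ : ℝ} (h₁ : -1 < γ₁) (h₂ : -1 < γ₂)
    (t : Fin p → ℂ) :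
    IsProbabilityMeasure (JUE N γ₁ γ₂) ∧
    Integrable (fun a => charProd t (herm a)) (JUE N γ₁ γ₂) ∧
    ∫ a, charProd t (herm a) ∂JUE N γ₁ γ₂ =
      ((∏ j ∈ Finset.Ico N (p + N), (-1 : ℝ) ^ j * (j.factorial : ℝ) *
          (Real.Gamma (j + γ₁ + γ₂ + 1) / Real.Gamma (2 * j + γ₁ + γ₂ + 1)) : ℝ) : ℂ) *
        MvPolynomial.aeval t (multiJacobi γ₁ γ₂ (rect N p)) := by
  classical
  have hΓ : ∀ n : ℕ, Real.Gamma (n + γ₁ + 1) ≠ 0 := fun n => by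
    have : (0 : ℝ) ≤ n := Nat.cast_nonneg n
    exact (Real.Gamma_pos_of_pos (by linarith)).ne'
  have hlead : ∀ n, (jacobiP γ₁ γ₂ n).coeff n =
      (-1) ^ n / n.factorial * (ascPochhammer ℝ n).eval (n + γ₁ + γ₂ + 1) := fun n => by
    rw [jacobiP_coeff γ₁ γ₂ le_rfl, Nat.sub_self, Nat.factorial_zero, Nat.cast_one, mul_one,
      div_self (hΓ n), mul_one]
  have hasc : ∀ n, (ascPochhammer ℝ n).eval (n + γ₁ + γ₂ + 1) ≠ 0 := fun n => by
    rcases Nat.eq_zero_or_pos n with rfl | hn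
    · simp
    · have : (1 : ℝ) ≤ n := by exact_mod_cast hn
      exact (ascPochhammer_pos n _ (by linarith)).ne'
  -- For n = 0 and γ₁ + γ₂ = -1 the Gamma quotient would be 0/0 = 0 by the default value of
  -- `Real.Gamma` at 0, not 1. The product starts at j = N ≥ 1, so this case never occurs.
  have hinv : ∀ n : ℕ, 1 ≤ n → ((jacobiP γ₁ γ₂ n).coeff n)⁻¹ = (-1) ^ n * n.factorial *
      (Real.Gamma (n + γ₁ + γ₂ + 1) / Real.Gamma (2 * n + γ₁ + γ₂ + 1)) := fun n hn => by
    have hn' : (1 : ℝ) ≤ n := by exact_mod_cast hn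
    have p2 : 0 < (n : ℝ) + γ₁ + γ₂ + 1 := by linarith
    have e : (2 : ℝ) * n + γ₁ + γ₂ + 1 = (n + γ₁ + γ₂ + 1) + n := by ring
    have g2 := (Real.Gamma_pos_of_pos p2).ne'
    have ha := hasc n
    rw [hlead, e, gamma_add_nat_eq p2, mul_inv, inv_div, div_eq_mul_inv _ ((-1 : ℝ) ^ n),
      mul_comm (n.factorial : ℝ), ← inv_pow,
      show (-1 : ℝ)⁻¹ = -1 by norm_num]
    field_simp
  have hw := integrable_pow_mul_jacobiWeight h₁ h₂
  have h := ensemble_average_charProd (N := N) (p := p) (w := jacobiWeight γ₁ γ₂)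
    (φ := jacobiP γ₁ γ₂)
    (f := fun M => if M.PosDef ∧ (1 - M).PosDef then M.det.re ^ γ₁ * (1 - M).det.re ^ γ₂ else 0)
    (measurable_jacobiWeight γ₁ γ₂) hw (jacobiWeight_nonneg γ₁ γ₂) ?_
    (fun n => natDegree_sum_monomial_le _ n) (fun n => ?_)
    (fun n => integral_mul_eq_zero_of_moments hw (integral_pow_mul_jacobiWeight h₁ h₂)
      (natDegree_sum_monomial_le _ n) fun m hm => sum_jacobiP_coeff_mul h₁ h₂ hm) ?_ ?_ ?_ t
  · rw [Finset.prod_congr rfl fun j hj =>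
      hinv j (hN.trans (Finset.mem_Ico.1 hj).1)] at h
    exact h
  · have hsub : Set.Ioo 0 1 ⊆ Function.support (jacobiWeight γ₁ γ₂) := fun x hx =>
      (jacobiWeight_pos hx).ne'
    refine (lt_of_lt_of_le ?_ (measure_mono hsub)).ne'
    simp
  · rw [hlead]
    have := Nat.factorial_ne_zero n
    exact mul_ne_zero (div_ne_zero (pow_ne_zero _ (by norm_num)) (by exact_mod_cast this)) (hasc n)
  · refine isClassFun_of_conj fun U A hU => ?_
    simp only [one_sub_conj hU, posDef_conj_iff hU, det_conj hU]
  · have c1 := continuous_herm (N := N)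
    have c2 : Continuous fun a : Fin N → Fin N → ℝ => 1 - herm a := continuous_const.sub c1
    have m1 := (Complex.continuous_re.comp c1.matrix_det).measurable
    have m2 := (Complex.continuous_re.comp c2.matrix_det).measurable
    exact Measurable.ite ((measurableSet_posDef c1 herm_isHermitian).inter
      (measurableSet_posDef c2 fun a => Matrix.isHermitian_one.sub (herm_isHermitian a)))
      ((m1.pow_const γ₁).mul (m2.pow_const γ₂)) measurable_const
  · intro x
    simp only [one_sub_diagonal, posDef_diagonal_iff', det_diagonal_re, jacobiWeight, sub_pos,
      ← forall_and]
    rw [prod_ite_forall]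
    split_ifs with hx
    · rw [Finset.prod_mul_distrib, Real.finsetProd_rpow _ _ fun i _ => (hx i).1.le,
        Real.finsetProd_rpow _ _ fun i _ => (sub_pos.2 (hx i).2).le]
    · rfl

end polynomial

end UnitaryEnsembles

end

theorem theorem1 (N p : ℕ) (hN : 1 ≤ N) (t : Fin p → ℂ) :
    -- (a) Hermite
    (IsProbabilityMeasure (UnitaryEnsembles.GUE N) ∧
      Integrable (fun a => UnitaryEnsembles.charProd t (UnitaryEnsembles.herm a))
        (UnitaryEnsembles.GUE N) ∧
      ∫ a, UnitaryEnsembles.charProd t (UnitaryEnsembles.herm a) ∂(UnitaryEnsembles.GUE N) =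
        MvPolynomial.aeval t (UnitaryEnsembles.multiHermite (UnitaryEnsembles.rect N p))) ∧
    -- (b) Laguerre
    (∀ γ : ℝ, -1 < γ →
      IsProbabilityMeasure (UnitaryEnsembles.LUE N γ) ∧
      Integrable (fun a => UnitaryEnsembles.charProd t (UnitaryEnsembles.herm a))
        (UnitaryEnsembles.LUE N γ) ∧
      ∫ a, UnitaryEnsembles.charProd t (UnitaryEnsembles.herm a) ∂(UnitaryEnsembles.LUE N γ) =
        ((∏ j ∈ Finset.Ico N (p + N), (-1 : ℝ) ^ j * (j.factorial : ℝ) : ℝ) : ℂ) *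
          MvPolynomial.aeval t (UnitaryEnsembles.multiLaguerre γ (UnitaryEnsembles.rect N p))) ∧
    -- (c) Jacobi
    (∀ γ₁ γ₂ : ℝ, -1 < γ₁ → -1 < γ₂ →
      IsProbabilityMeasure (UnitaryEnsembles.JUE N γ₁ γ₂) ∧
      Integrable (fun a => UnitaryEnsembles.charProd t (UnitaryEnsembles.herm a))
        (UnitaryEnsembles.JUE N γ₁ γ₂) ∧
      ∫ a, UnitaryEnsembles.charProd t (UnitaryEnsembles.herm a) ∂(UnitaryEnsembles.JUE N γ₁ γ₂) =
        ((∏ j ∈ Finset.Ico N (p + N), (-1 : ℝ) ^ j * (j.factorial : ℝ) *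
            (Real.Gamma (j + γ₁ + γ₂ + 1) / Real.Gamma (2 * j + γ₁ + γ₂ + 1)) : ℝ) : ℂ) *
          MvPolynomial.aeval t
            (UnitaryEnsembles.multiJacobi γ₁ γ₂ (UnitaryEnsembles.rect N p))) := by
  exact ⟨UnitaryEnsembles.GUE_average t, fun γ hγ => UnitaryEnsembles.LUE_average hγ t,
    fun γ₁ γ₂ h₁ h₂ => UnitaryEnsembles.JUE_average hN h₁ h₂ t⟩
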